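/- Consider a multi-access relay network with $J$ single-antenna sources, one $M$-antenna relay and one $N$-antenna destination, $1\le J\le\min\{M,N\}$, without direct links. The channel coefficients $f_i^{(j)}$ (Source $j$ to relay antenna $i$) and $g_{in}$ (relay antenna $i$ to destination antenna $n$) are i.i.d. $\mathcal{CN}(0,1)$ and stay constant during a transmission block; all noise samples are i.i.d. $\mathcal{CN}(0,1)$; the destination knows all channels and the relay knows none. Let $T=2^{m+1}\ge M$ (the protocol uses the smallest such $T$). The protocol DSTC-ICRec works as follows. Step 1: all sources transmit concurrently; Source $j$ sends $T$ symbols $s_k^{(j)}$ with power $P$, and relay antenna $i$ receives $\mathbf r_i=\sqrt P\sum_j f_i^{(j)}\mathbf s^{(j)}+\mathbf v_i$. Step 2: relay antenna $i$ sends $\mathbf t_i=\sqrt{P/(M(JP+1))}\,\mathbf C_i(\mathbf r_i)$, where $\mathbf C_1(\mathbf r),\dots,\mathbf C_M(\mathbf r)$ are $M$ distinct columns of the $T\times T$ quasi-orthogonal space-time code with ABBA structure (the Alamouti code $\begin{bmatrix} r_1&-\overline{r_2}\\ r_2&\overline{r_1}\end{bmatrix}$, doubled $m$ times by $(A,B)\mapsto\begin{bmatrix}A&B\\B&A\end{bmatrix}$).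 The destination receives $\mathbf x_n=\sum_i g_{in}\mathbf t_i+\mathbf w_n$ at antenna $n$. Decoding of a given source $j_0$: the destination separates the received signals into $T/2$ Alamouti systems with $2\times2$ equivalent channel matrices $\mathbf H_n^{(j)}$, and in each of them it cancels the other $J-1$ sources one after the other by zero-forcing: to cancel Source $j$, the last remaining observation block $p$ is used to replace every other remaining block $\mathbf y_n$ by $\frac{2\mathbf E_n^*}{\|\mathbf E_n\|^2}\mathbf y_n-\frac{2\mathbf E_p^*}{\|\mathbf E_p\|^2}\mathbf y_p$, where $\mathbf E_n$ is the current equivalent channel matrix of Source $j$ in block $n$. Let $\mathbf h_k$ be the resulting equivalent channel vector of the symbol $s_k^{(j_0)}$ (or of its conjugate) without the power factor $\sqrt{P}\sqrt{P/(M(JP+1))}$, let $\mathbf R$ be the covariance matrix, given the channels, of the remaining noise, and let $\gamma=\mathbf h_k^*\mathbf R^{-1}\mathbf h_k$ be the instantaneous normalized receive SNR. Then the diversity gain of DSTC-ICRec is at most $M-J+1$, in both of the following senses, for every source $j_0$. (a) For every $P>0$ and every symbol index $k$, $$\limsup_{\epsilon\to0^+}\frac{\log \mathbb P(\gamma<\epsilon)}{\log\epsilon}\le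 M-J+1 .$$ (b) Suppose that every symbol carries $q\ge1$ bits through a labelled constellation that does not depend on $P$ (it may depend on the symbol index $k$), that all bits are independent and uniform, and that Source $j_0$ is decoded by any measurable rule (which may depend on $P$; for instance maximum likelihood) from the channels and the observation after interference cancellation. Then the bit error rate of Source $j_0$ satisfies $$\limsup_{P\to\infty}\frac{-\log \mathrm{BER}(P)}{\log P}\le M-J+1 .$$ -/

import Mathlib

open MeasureTheory ProbabilityTheory Filter Topology
open scoped ENNReal NNReal Matrix ComplexConjugate

namespace MARN

noncomputable section

/-! ### Random channels and noises -/

/-- The circularly symmetric complex Gaussian law `CN(0,1)`: independent real and imaginary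
parts, each real Gaussian with mean `0` and variance `1/2`. -/
def stdCN : Measure ℂ :=
  ((gaussianReal 0 (1 / 2)).prod (gaussianReal 0 (1 / 2))).map
    Complex.measurableEquivRealProd.symm

/-- Channel coefficients `(f, g)`: `f j i` from Source `j` to relay antenna `i`, and `g i n` from
relay antenna `i` to destination antenna `n`. -/
abbrev Channel (J M N : ℕ) : Type := (Fin J → Fin M → ℂ) × (Fin M → Fin N → ℂ)

/-- All channel coefficients are i.i.d. `CN(0,1)`. -/
def channelLaw (J M N : ℕ) : Measure (Channel J M N) :=
  (Measure.pi fun _ => Measure.pi fun _ => stdCN).prod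
    (Measure.pi fun _ => Measure.pi fun _ => stdCN)

/-- The `2 ^ (m + 1)` time slots of one step of the protocol. They also index the symbols sent by
one source, and the columns of the space-time code. Slot `(a, t)` is the `a`-th slot of the `t`-th
Alamouti block. -/
abbrev Slot (m : ℕ) : Type := Fin 2 × (Fin m → ZMod 2)

/-- Noises `(v, w)`: `v i τ` at relay antenna `i`, and `w n τ` at destination antenna `n`. -/
abbrev Noise (m M N : ℕ) : Type := (Fin M → Slot m → ℂ) × (Fin N → Slot m → ℂ)

/-- All noises are i.i.d. `CN(0,1)`. -/
def noiseLaw (m M N : ℕ) : Measure (Noise m M N) :=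
  (Measure.pi fun _ => Measure.pi fun _ => stdCN).prod
    (Measure.pi fun _ => Measure.pi fun _ => stdCN)

/-! ### The relay's distributed space-time code -/

/-- Column `κ` of the `2 ^ (m + 1) × 2 ^ (m + 1)` quasi-orthogonal space-time code with ABBA
structure, in the variables `r`. The code is obtained from the Alamouti code
`[r₁, -conj r₂; r₂, conj r₁]` by the doubling `(A, B) ↦ [A, B; B, A]` iterated `m` times; a doubling
adds one coordinate in `ZMod 2` to the second component of the index, and the block index that
occurs in row block `t` and column block `k` is `t + k`. Every column is a linear function either of
`r` or of `conj r`. -/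
def codeColumn {m : ℕ} (κ : Slot m) (r : Slot m → ℂ) (τ : Slot m) : ℂ :=
  if κ.1 = 0 then r (τ.1, τ.2 + κ.2)
  else if τ.1 = 0 then -conj (r (1, τ.2 + κ.2))
  else conj (r (0, τ.2 + κ.2))

/-- For `m = 0` the code is the Alamouti code. -/
theorem codeColumn_alamouti (r : Slot 0 → ℂ) :
    (Matrix.of fun a b : Fin 2 => codeColumn (b, 0) r (a, 0)) =
      !![r (0, 0), -conj (r (1, 0)); r (1, 0), conj (r (0, 0))] := by
  ext a b
  fin_cases a <;> fin_cases b <;> simp [codeColumn]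

/-- For `m = 1` the code is, up to the labelling and the signs of symbols, of time slots and of
antennas, the `4 × 4` quasi-orthogonal code with columns
`s`, `(-conj s₂, conj s₁, -conj s₄, conj s₃)`, `(-conj s₃, -conj s₄, conj s₁, conj s₂)` and
`(s₄, -s₃, -s₂, s₁)`. -/
theorem codeColumn_quasiOrthogonal (s : Fin 4 → ℂ) :
    let r : Slot 1 → ℂ := fun k =>
      if k.2 0 = 0 then (if k.1 = 0 then s 0 else s 1) else (if k.1 = 0 then s 3 else -s 2)
    let slot : Fin 4 → Slot 1 := ![(0, ![0]), (1, ![0]), (1, ![1]), (0, ![1])]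
    let antenna : Fin 4 → Slot 1 := ![(0, ![0]), (1, ![0]), (1, ![1]), (0, ![1])]
    (Matrix.of fun τ i : Fin 4 =>
      (![1, 1, -1, 1] τ : ℂ) * (![1, 1, -1, 1] i : ℂ) * codeColumn (antenna i) r (slot τ)) =
      !![s 0, -conj (s 1), -conj (s 2), s 3;
         s 1, conj (s 0), -conj (s 3), -s 2;
         s 2, -conj (s 3), conj (s 0), -s 1;
         s 3, conj (s 2), conj (s 1), s 0] := by
  have h11 : (1 : ZMod 2) + 1 = 0 := by decide
  ext τ i
  fin_cases τ <;> fin_cases i <;> simp [codeColumn, h11]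

/-- Signal received by relay antenna `i`, all sources transmitting concurrently with power `P`. -/
def relayReceived {m J M N : ℕ} (P : ℝ) (ch : Channel J M N) (s : Fin J → Slot m → ℂ)
    (v : Fin M → Slot m → ℂ) (i : Fin M) (τ : Slot m) : ℂ :=
  (√P : ℂ) * ∑ j, ch.1 j i * s j τ + v i τ

/-- The factor that normalizes the average power of the relay to `P`. -/
def relayGain (J M : ℕ) (P : ℝ) : ℝ := √(P / (M * (J * P + 1)))

/-- Signal received by destination antenna `n`: relay antenna `i` has encoded its received signal
with the column `col i` of the space-time code. -/
def destReceived {m J M N : ℕ} (col : Fin M → Slot m) (P : ℝ) (ch : Channel J M N)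
    (s : Fin J → Slot m → ℂ) (z : Noise m M N) (n : Fin N) (τ : Slot m) : ℂ :=
  ∑ i, ch.2 i n * ((relayGain J M P : ℂ) * codeColumn (col i) (relayReceived P ch s z.1 i) τ)
    + z.2 n τ

/-! ### Zero-forcing interference cancellation at the destination -/

/-- The sign `± 1` of block `t` in the `u`-th Alamouti system. -/
def sgn {m : ℕ} (u t : Fin m → ZMod 2) : ℂ := ∏ l, if u l = 1 ∧ t l = 1 then -1 else 1

/-- The observation in the `u`-th of the `2 ^ m` Alamouti systems into which the received signal
`x` of one antenna is separated. -/
def separate {m : ℕ} (x : Slot m → ℂ) (u : Fin m → ZMod 2) : Fin 2 → ℂ :=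
  ![∑ t, sgn u t * x (0, t), conj (∑ t, sgn u t * x (1, t))]

/-- The equivalent `2 × 2` channel matrix of Source `j` at destination antenna `n` in the `u`-th
Alamouti system. It acts on the vector of `∑ t, sgn u t * s j (0, t)` and
`conj (∑ t, sgn u t * s j (1, t))`. -/
def eqChannel {m J M N : ℕ} (col : Fin M → Slot m) (ch : Channel J M N) (u : Fin m → ZMod 2)
    (n : Fin N) (j : Fin J) : Matrix (Fin 2) (Fin 2) ℂ :=
  let p : ℂ := ∑ i, if (col i).1 = 0 then sgn u (col i).2 * (ch.1 j i * ch.2 i n) else 0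
  let q : ℂ := ∑ i, if (col i).1 = 0 then 0 else sgn u (col i).2 * (ch.1 j i * conj (ch.2 i n))
  !![p, -conj q; q, conj p]

/-- The squared Frobenius norm. -/
def frobSq (A : Matrix (Fin 2) (Fin 2) ℂ) : ℝ := ∑ a, ∑ b, ‖A a b‖ ^ 2

/-- One block of an interference cancellation step, `(2 Eₙᴴ / ‖Eₙ‖²) X - (2 Eₚᴴ / ‖Eₚ‖²) Y`, written
over a common denominator (so that the block is zero on the null event where a norm vanishes and the
formula has no meaning). -/
def icStep (En Ep X Y : Matrix (Fin 2) (Fin 2) ℂ) : Matrix (Fin 2) (Fin 2) ℂ :=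
  (2 / (frobSq En * frobSq Ep) : ℂ) •
    ((frobSq Ep : ℂ) • (Enᴴ * X) - (frobSq En : ℂ) • (Epᴴ * Y))

theorem icStep_eq {En Ep : Matrix (Fin 2) (Fin 2) ℂ} (hn : frobSq En ≠ 0) (hp : frobSq Ep ≠ 0)
    (X Y : Matrix (Fin 2) (Fin 2) ℂ) :
    icStep En Ep X Y = (2 / frobSq En : ℂ) • (Enᴴ * X) - (2 / frobSq Ep : ℂ) • (Epᴴ * Y) := by
  have hn' : (frobSq En : ℂ) ≠ 0 := by exact_mod_cast hn
  have hp' : (frobSq Ep : ℂ) ≠ 0 := by exact_mod_cast hp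
  rw [icStep, smul_sub, smul_smul, smul_smul]
  congr 2 <;> field_simp

/-- The `2 × 2` blocks of the matrix of the iterative interference cancellation in one Alamouti
system with channel matrices `H n j`. The sources in the list are cancelled one after the other,
the last one in the list first. Each step uses the last remaining observation block to cancel a
source from all other ones, so that after `l.length` steps the observation blocks
`n < N - l.length` remain; observation block `n` is the sum over `n'` of
`icFilter H l n n'` times the observation at antenna `n'`. -/
def icFilter {J N : ℕ} (H : Fin N → Fin J → Matrix (Fin 2) (Fin 2) ℂ) :
    List (Fin J) → ℕ → Fin N → Matrix (Fin 2) (Fin 2) ℂ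
  | [], n, n' => if n = n'.val then 1 else 0
  | j :: l, n, n' =>
    let E : ℕ → Matrix (Fin 2) (Fin 2) ℂ := fun i => ∑ n'', icFilter H l i n'' * H n'' j
    let p : ℕ := N - 1 - l.length
    icStep (E n) (E p) (icFilter H l n n') (icFilter H l p n')

/-- The sources other than `j₀`, in increasing order. -/
def interferers {J : ℕ} (j₀ : Fin J) : List (Fin J) := (List.finRange J).filter (· ≠ j₀)

/-- Indices `(u, n, a)` of the observations that are left after interference cancellation: entry `a`
of block `n` in the `u`-th Alamouti system. -/
abbrev ObsIdx (m J N : ℕ) : Type := (Fin m → ZMod 2) × Fin (N - (J - 1)) × Fin 2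

/-- The observation vector after cancellation of all sources but `j₀`, from the signals `x n`
received by the destination antennas. -/
def afterIC {m J M N : ℕ} (col : Fin M → Slot m) (ch : Channel J M N) (j₀ : Fin J)
    (x : Fin N → Slot m → ℂ) : ObsIdx m J N → ℂ := fun o =>
  (∑ n', icFilter (eqChannel col ch o.1) (interferers j₀) o.2.1 n' *ᵥ separate (x n') o.1) o.2.2

/-- The observation vector, for transmitted symbols `s` and noises `z`, from which the symbols of
Source `j₀` are decoded. -/
def observation {m J M N : ℕ} (col : Fin M → Slot m) (P : ℝ) (ch : Channel J M N) (j₀ : Fin J)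
    (s : Fin J → Slot m → ℂ) (z : Noise m M N) : ObsIdx m J N → ℂ :=
  afterIC col ch j₀ (destReceived col P ch s z)

/-! ### Normalized receive SNR, outage and diversity gain -/

/-- The equivalent channel vector, after interference cancellation, of the symbol
`k = (a, t)` of Source `j₀` (of its conjugate if `a = 1`), without the power factor
`√P * relayGain J M P`. -/
def channelVector {m J M N : ℕ} (col : Fin M → Slot m) (ch : Channel J M N) (j₀ : Fin J)
    (k : Slot m) : ObsIdx m J N → ℂ := fun o =>
  sgn o.1 k.2 * (∑ n', icFilter (eqChannel col ch o.1) (interferers j₀) o.2.1 n' *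
    eqChannel col ch o.1 n' j₀) o.2.2 k.1

/-- The covariance matrix `E[n nᴴ]`, for given channels, of the noise that is left after
interference cancellation (the observation when no symbols are sent). -/
def noiseCov {m J M N : ℕ} (col : Fin M → Slot m) (P : ℝ) (ch : Channel J M N) (j₀ : Fin J) :
    Matrix (ObsIdx m J N) (ObsIdx m J N) ℂ := Matrix.of fun o o' =>
  ∫ z, observation col P ch j₀ 0 z o * conj (observation col P ch j₀ 0 z o')
    ∂(noiseLaw m M N)

/-- The instantaneous normalized receive SNR `hᴴ R⁻¹ h` of the symbol `k` of Source `j₀`. -/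
def receiveSNR {m J M N : ℕ} (col : Fin M → Slot m) (P : ℝ) (j₀ : Fin J) (k : Slot m)
    (ch : Channel J M N) : ℝ :=
  (star (channelVector col ch j₀ k) ⬝ᵥ
    ((noiseCov col P ch j₀)⁻¹ *ᵥ channelVector col ch j₀ k)).re

/-- The diversity gain `lim log P(γ < ε) / log ε`, as `ε → 0+`, computed from the outage probability
of the normalized receive SNR; it is taken as an upper limit, so that nothing is presupposed about
convergence. -/
def outageDiversity {m J M : ℕ} (N : ℕ) (col : Fin M → Slot m) (P : ℝ) (j₀ : Fin J)
    (k : Slot m) : EReal :=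
  limsup (fun ε : ℝ =>
    ENNReal.log (channelLaw J M N {ch | receiveSNR col P j₀ k ch < ε}) / (Real.log ε : EReal))
    (𝓝[>] 0)

/-- The bit error rate of Source `j₀` at power `P`. Each source sends `2 ^ (m + 1)` symbols, each of
which carries `q` bits through the labelled constellation `mod k`; the bits `b` are independent and
uniform; the decoder `D` knows the channels and the observation after interference cancellation. -/
def bitErrorRate {m J M N q : ℕ} (col : Fin M → Slot m) (mod : Slot m → (Fin q → Bool) → ℂ)
    (j₀ : Fin J) (D : Channel J M N → (ObsIdx m J N → ℂ) → Slot m → Fin q → Bool) (P : ℝ) : ℝ≥0∞ :=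
  ∫⁻ ch, ∫⁻ z,
    (∑ b : Fin J → Slot m → Fin q → Bool, ∑ k : Slot m, ∑ i : Fin q,
      if D ch (observation col P ch j₀ (fun j τ => mod τ (b j τ)) z) k i = b j₀ k i
        then 0 else 1) /
      ((Fintype.card (Fin J → Slot m → Fin q → Bool) * Fintype.card (Slot m) * q : ℕ) : ℝ≥0∞)
    ∂(noiseLaw m M N) ∂(channelLaw J M N)

/-- The diversity gain `lim - log BER(P) / log P`, as `P → ∞`: the negative of the asymptotic slope
of the bit error rate against the transmit SNR `P` (all noises have unit power), taken as an upper
limit. The decoder may depend on `P`. -/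
def berDiversity {m J M N q : ℕ} (col : Fin M → Slot m) (mod : Slot m → (Fin q → Bool) → ℂ)
    (j₀ : Fin J) (D : ℝ → Channel J M N → (ObsIdx m J N → ℂ) → Slot m → Fin q → Bool) : EReal :=
  limsup (fun P : ℝ => -ENNReal.log (bitErrorRate col mod j₀ (D P) P) / (Real.log P : EReal)) atTop

end

end MARN

/-!
The diversity gain is limited by channels that zero forcing cannot separate. Suppose that the
channel vector of Source `j₀` to the relay is within `δ` of a linear combination `∑ j, c j • f j` of
the channel vectors of the other sources. A complex factor on a channel vector may be moved to the
symbols, so the part of the received signal of Source `j₀` that comes from this combination looks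
like signals of the other sources, and interference cancellation removes it
(`afterIC_relaySignal_sub_sum`). What is left is the processed image of a signal of size `O(δ)` at
the destination antennas, and it is masked by the destination's own noise, which passes through the
same real-linear processing (`noiseLinear_dest`).

Only two facts on the Gaussian laws are needed: they dominate a multiple of Lebesgue measure on
bounded sets (`DominatesVolume`), and they have second moments. As Lebesgue measure is invariant
under translations, no test detects a bounded shift of the noise reliably
(`DominatesVolume.exists_le_measure_add`). Applied to slabs it says that linear functionals
of the noise have second moments comparable to their squared norms, whence the normalized SNR is
`O(δ²)` near such channels (`receiveSNR_le_of_mem`). Applied to the decoder with `δ` of order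
`P ^ (-1/2)` it says that the error probability near such channels is bounded below
(`exists_le_lintegral_errors`).

Such channels have probability at least of order `δ ^ (2 * (M - J + 1))`
(`exists_le_channelLaw_alignedChannels`): `J - 1` generic vectors of `ℂ ^ M` together with short
vectors in the remaining `M - J + 1` complex directions span a parallelepiped of that volume.
-/

namespace MARN

open Metric

/-! ### Measures that dominate Lebesgue measure on bounded sets -/

/-- The measure `μ` dominates a positive multiple of the volume on every ball about `0`. The
multiple may depend on the ball. -/
def DominatesVolume {E : Type*} [NormedAddCommGroup E] [MeasureSpace E] (μ : Measure E) : Prop :=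
  ∀ R : ℝ, ∃ κ : ℝ≥0, κ ≠ 0 ∧ κ • (volume : Measure E).restrict (ball 0 R) ≤ μ

lemma dominatesVolume_gaussianReal {v : ℝ≥0} (hv : v ≠ 0) :
    DominatesVolume (gaussianReal 0 v) := by
  intro R
  have hpos := gaussianPDFReal_pos 0 v R hv
  refine ⟨(gaussianPDFReal 0 v R).toNNReal, (Real.toNNReal_pos.2 hpos).ne', ?_⟩
  rw [gaussianReal_of_var_ne_zero _ hv]
  refine Measure.le_iff.2 fun s hs => ?_
  rw [withDensity_apply _ hs, Measure.smul_apply, Measure.restrict_apply hs]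
  calc _ = ∫⁻ _ in s ∩ ball 0 R, ENNReal.ofReal (gaussianPDFReal 0 v R) := by
        rw [setLIntegral_const]
        rfl
    _ ≤ ∫⁻ x in s ∩ ball 0 R, gaussianPDF 0 v x := by
        refine setLIntegral_mono (measurable_gaussianPDF _ _) fun x hx => ?_
        refine ENNReal.ofReal_le_ofReal ?_
        have hx' : |x| < R := by simpa using hx.2
        have : x ^ 2 ≤ R ^ 2 := sq_le_sq' (abs_lt.1 hx').1.le (abs_lt.1 hx').2.le
        simp only [gaussianPDFReal, sub_zero]
        gcongr
    _ ≤ _ := lintegral_mono_set Set.inter_subset_left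

lemma DominatesVolume.prod {E F : Type*} [NormedAddCommGroup E] [MeasureSpace E]
    [NormedAddCommGroup F] [MeasureSpace F] [SFinite (volume : Measure E)]
    [SFinite (volume : Measure F)]
    {μ : Measure E} {ν : Measure F} [SFinite μ] [SFinite ν]
    (hμ : DominatesVolume μ) (hν : DominatesVolume ν) : DominatesVolume (μ.prod ν) := by
  intro R
  obtain ⟨κ, hκ, h⟩ := hμ R
  obtain ⟨l, hl, h'⟩ := hν R
  refine ⟨κ * l, mul_ne_zero hκ hl, ?_⟩
  have : (κ * l) • (volume : Measure (E × F)).restrict (ball 0 R) =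
      (κ • (volume : Measure E).restrict (ball 0 R)).prod
        (l • (volume : Measure F).restrict (ball 0 R)) := by
    rw [show (0 : E × F) = (0, 0) from rfl, ← ball_prod_same, Measure.volume_eq_prod,
      ← Measure.prod_restrict]
    have e1 (μ : Measure E) : κ • μ = (κ : ℝ≥0∞) • μ := rfl
    have e2 (μ : Measure F) : l • μ = (l : ℝ≥0∞) • μ := rfl
    have e3 (μ : Measure (E × F)) : (κ * l) • μ = ((κ : ℝ≥0∞) * l) • μ := by
      rw [← ENNReal.coe_mul]; rfl
    rw [e1, e2, e3, Measure.prod_smul_left, Measure.prod_smul_right, smul_smul]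
  rw [this]
  exact Measure.prod_mono h h'

lemma DominatesVolume.pi {ι E : Type*} [Fintype ι] [NormedAddCommGroup E] [MeasureSpace E]
    [SigmaFinite (volume : Measure E)] {μ : Measure E} [SigmaFinite μ]
    (hμ : DominatesVolume μ) : DominatesVolume (Measure.pi fun _ : ι => μ) := by
  intro R
  -- a ball of nonpositive radius is no product of balls when `ι` is empty
  wlog hR : 0 < R generalizing R
  · obtain ⟨κ, hκ, h⟩ := this 1 one_pos
    refine ⟨κ, hκ, le_trans ?_ h⟩
    gcongr
    linarith
  obtain ⟨κ, hκ, h⟩ := hμ R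
  refine ⟨κ ^ Fintype.card ι, pow_ne_zero _ hκ, Measure.le_iff.2 fun s hs => ?_⟩
  rw [Measure.pi, toMeasure_apply _ _ hs]
  refine (OuterMeasure.le_pi (n := (κ ^ Fintype.card ι •
    (volume : Measure (ι → E)).restrict (ball 0 R)).toOuterMeasure)).2 (fun t _ => ?_) s
  change (κ ^ Fintype.card ι • (volume : Measure (ι → E)).restrict (ball 0 R)) _ ≤ ∏ i, μ (t i)
  rw [ball_pi _ hR, volume_pi, Measure.restrict_pi_pi, Measure.smul_apply, Measure.pi_pi]
  calc _ = ∏ i, (κ • (volume : Measure E).restrict (ball 0 R)) (t i) := by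
        simp only [Measure.smul_apply, ENNReal.smul_def, smul_eq_mul, Finset.prod_mul_distrib,
          Finset.prod_const, Finset.card_univ, ENNReal.coe_pow]
        rfl
    _ ≤ _ := Finset.prod_le_prod' fun i _ => h (t i)

instance isProbabilityMeasure_stdCN : IsProbabilityMeasure stdCN :=
  Measure.isProbabilityMeasure_map (by fun_prop)

lemma dominatesVolume_stdCN : DominatesVolume stdCN := by
  intro R
  have hv : (1 / 2 : ℝ≥0) ≠ 0 := by simp
  obtain ⟨κ, hκ, h⟩ := (dominatesVolume_gaussianReal hv).prod (dominatesVolume_gaussianReal hv) R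
  refine ⟨κ, hκ, ?_⟩
  have hvol := Complex.volume_preserving_equiv_real_prod.symm
  refine Measure.le_iff.2 fun s hs => ?_
  rw [stdCN, Measure.map_apply (by fun_prop) hs]
  refine le_trans ?_ (h _)
  rw [Measure.smul_apply, Measure.smul_apply, Measure.restrict_apply hs,
    Measure.restrict_apply (Complex.measurableEquivRealProd.symm.measurable hs),
    ← hvol.measure_preimage (hs.inter measurableSet_ball).nullMeasurableSet]
  gcongr
  rw [Set.preimage_inter]
  refine Set.inter_subset_inter_right _ fun x hx => ?_
  simp only [Set.mem_preimage, mem_ball_zero_iff] at hx ⊢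
  rw [Prod.norm_def]
  have h1 := Complex.abs_re_le_norm (Complex.measurableEquivRealProd.symm x)
  have h2 := Complex.abs_im_le_norm (Complex.measurableEquivRealProd.symm x)
  exact max_lt (h1.trans_lt hx) (h2.trans_lt hx)

instance (m M N : ℕ) : IsProbabilityMeasure (noiseLaw m M N) := by
  unfold noiseLaw; infer_instance

lemma dominatesVolume_noiseLaw (m M N : ℕ) : DominatesVolume (noiseLaw m M N) :=
  dominatesVolume_stdCN.pi.pi.prod dominatesVolume_stdCN.pi.pi

lemma DominatesVolume.pos_of_isOpen {E : Type*} [NormedAddCommGroup E] [MeasureSpace E]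
    [(volume : Measure E).IsOpenPosMeasure] {μ : Measure E} (hμ : DominatesVolume μ)
    {U : Set E} (hU : IsOpen U) (hne : U.Nonempty) : 0 < μ U := by
  obtain ⟨x, hx⟩ := hne
  obtain ⟨κ, hκ, h⟩ := hμ (‖x‖ + 1)
  refine lt_of_lt_of_le ?_ (h U)
  rw [Measure.smul_apply, ENNReal.smul_def, smul_eq_mul]
  refine ENNReal.mul_pos (by simpa using hκ) (ne_of_gt ?_)
  refine lt_of_lt_of_le ?_ (Measure.le_restrict_apply _ _)
  exact (hU.inter isOpen_ball).measure_pos _ ⟨x, hx, by simp⟩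

/-! ### Shifts by bounded vectors -/

/-- No test detects a bounded shift of the noise: its two error probabilities cannot both be small.
The volume of the unit ball is split by `A` and its complement, and the shift moves the second
part within the ball of radius `2`. -/
lemma DominatesVolume.exists_le_measure_add {E : Type*} [NormedAddCommGroup E] [MeasureSpace E]
    [BorelSpace E] [(volume : Measure E).IsOpenPosMeasure]
    [(volume : Measure E).IsAddLeftInvariant] {μ : Measure E} (hμ : DominatesVolume μ) :
    ∃ c : ℝ≥0∞, c ≠ 0 ∧ ∀ η : E, ‖η‖ ≤ 1 → ∀ A : Set E,
      c ≤ μ A + μ ((fun z => η + z) ⁻¹' Aᶜ) := by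
  obtain ⟨κ, hκ, h⟩ := hμ 2
  refine ⟨κ * volume (ball (0 : E) 1), mul_ne_zero (by simpa using hκ)
    (measure_ball_pos _ _ one_pos).ne', fun η hη A => ?_⟩
  have key (B : Set E) (hB : B ⊆ ball 0 2) : κ * volume B ≤ μ B := by
    refine le_trans ?_ (h B)
    rw [Measure.smul_apply, ENNReal.smul_def, smul_eq_mul]
    refine mul_le_mul_right (le_trans ?_ (Measure.le_restrict_apply _ _)) _
    rw [Set.inter_eq_left.2 hB]
  calc κ * volume (ball (0 : E) 1)
      ≤ κ * (volume (A ∩ ball 0 1) + volume (Aᶜ ∩ ball 0 1)) := by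
        gcongr
        refine le_trans (measure_mono fun x hx => ?_) (measure_union_le _ _)
        by_cases hA : x ∈ A
        exacts [Or.inl ⟨hA, hx⟩, Or.inr ⟨hA, hx⟩]
    _ = κ * volume (A ∩ ball 0 1) +
          κ * volume ((fun z => η + z) ⁻¹' (Aᶜ ∩ ball 0 1)) := by
        rw [mul_add, measure_preimage_add]
    _ ≤ μ (A ∩ ball 0 1) + μ ((fun z => η + z) ⁻¹' (Aᶜ ∩ ball 0 1)) := by
        refine add_le_add (key _ fun x hx => ?_) (key _ fun x hx => ?_)
        · exact ball_subset_ball (by norm_num) hx.2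
        · have := hx.2
          simp only [mem_ball_zero_iff] at this ⊢
          calc ‖x‖ = ‖(η + x) - η‖ := by simp
            _ ≤ ‖η + x‖ + ‖η‖ := norm_sub_le _ _
            _ < 2 := by linarith
    _ ≤ _ := by gcongr <;> exact fun x hx => hx.1

/-- A linear functional of a random vector whose law dominates the volume near `0` has second
moment at least a multiple of its squared norm: the shift by `η` changes the functional by `φ η`,
and yet no test detects it, so that `‖φ z‖ ≥ ‖φ η‖ / 2` with at least constant probability. -/
lemma DominatesVolume.exists_sq_norm_le {E : Type*} [NormedAddCommGroup E] [NormedSpace ℝ E]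
    [MeasureSpace E]
    [BorelSpace E] [(volume : Measure E).IsOpenPosMeasure]
    [(volume : Measure E).IsAddLeftInvariant] {μ : Measure E} [IsFiniteMeasure μ]
    (hμ : DominatesVolume μ) :
    ∃ C : ℝ, 0 < C ∧ ∀ φ : E →ₗ[ℝ] ℂ, Integrable (fun z => ‖φ z‖ ^ 2) μ → ∀ η : E, ‖η‖ ≤ 1 →
      ‖φ η‖ ^ 2 ≤ C * ∫ z, ‖φ z‖ ^ 2 ∂μ := by
  obtain ⟨c, hc, h⟩ := hμ.exists_le_measure_add
  have hct : c ≠ ⊤ := ne_top_of_le_ne_top (by finiteness) (h 0 (by simp) Set.univ)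
  have hc0 : 0 < c.toReal := ENNReal.toReal_pos hc hct
  refine ⟨8 / c.toReal, by positivity, fun φ hφ η hη => ?_⟩
  set a := ‖φ η‖ with ha
  have h1 := h η hη {z | (a / 2) ^ 2 ≤ ‖φ z‖ ^ 2}
  have hsub : (fun z => η + z) ⁻¹' {z | (a / 2) ^ 2 ≤ ‖φ z‖ ^ 2}ᶜ ⊆
      {z | (a / 2) ^ 2 ≤ ‖φ z‖ ^ 2} := by
    intro z hz
    simp only [Set.mem_preimage, Set.mem_compl_iff, Set.mem_ofPred_eq, not_le, map_add] at hz ⊢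
    have h3 : ‖φ η + φ z‖ < a / 2 := lt_of_pow_lt_pow_left₀ 2 (by positivity) hz
    have h4 : a ≤ ‖φ η + φ z‖ + ‖φ z‖ := by
      simpa using norm_sub_le (φ η + φ z) (φ z)
    gcongr
    linarith
  have h2 : c.toReal ≤ 2 * μ.real {z | (a / 2) ^ 2 ≤ ‖φ z‖ ^ 2} := by
    have := h1.trans (add_le_add_right (measure_mono hsub) _)
    rw [← two_mul] at this
    simpa [Measure.real] using ENNReal.toReal_mono (by finiteness) this
  have h3 := mul_meas_ge_le_integral_of_nonneg (Eventually.of_forall fun z => by positivity) hφ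
    ((a / 2) ^ 2)
  rw [div_mul_eq_mul_div, le_div_iff₀ hc0]
  nlinarith [mul_le_mul_of_nonneg_left h2 (sq_nonneg a)]

/-! ### Second moments -/

lemma integrable_sq_norm_stdCN : Integrable (fun z : ℂ => ‖z‖ ^ 2) stdCN := by
  rw [stdCN, integrable_map_equiv]
  have h : Integrable (fun x : ℝ => x ^ 2) (gaussianReal 0 (1 / 2)) :=
    (memLp_id_gaussianReal 2).integrable_sq
  refine ((h.comp_fst _).add (h.comp_snd _)).congr (Eventually.of_forall fun x => ?_)
  change x.1 ^ 2 + x.2 ^ 2 = ‖(⟨x.1, x.2⟩ : ℂ)‖ ^ 2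
  rw [← Complex.normSq_eq_norm_sq, Complex.normSq_mk]
  ring

lemma integrable_sq_norm_pi {ι E : Type*} [Fintype ι] [NormedAddCommGroup E] [MeasurableSpace E]
    [OpensMeasurableSpace E] [SecondCountableTopology E] {μ : Measure E} [IsProbabilityMeasure μ]
    (h : Integrable (fun x => ‖x‖ ^ 2) μ) :
    Integrable (fun x : ι → E => ‖x‖ ^ 2) (Measure.pi fun _ => μ) := by
  have h1 : Integrable (fun x : ι → E => ∑ i, ‖x i‖ ^ 2) (Measure.pi fun _ => μ) :=
    integrable_finsetSum _ fun i _ =>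
      (measurePreserving_eval (fun _ : ι => μ) i).integrable_comp_of_integrable h
  refine h1.mono' (by fun_prop) (Eventually.of_forall fun x => ?_)
  rw [Real.norm_of_nonneg (by positivity)]
  obtain _ | _ := isEmpty_or_nonempty ι
  · simp [Subsingleton.elim x 0]
  · obtain ⟨i, hi⟩ := Finite.exists_max (fun i => ‖x i‖)
    have : ‖x‖ ≤ ‖x i‖ := (pi_norm_le_iff_of_nonneg (norm_nonneg _)).2 hi
    calc ‖x‖ ^ 2 ≤ ‖x i‖ ^ 2 := by gcongr
      _ ≤ _ := Finset.single_le_sum (f := fun i => ‖x i‖ ^ 2) (fun _ _ => by positivity)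
          (Finset.mem_univ i)

lemma integrable_sq_norm_noiseLaw (m M N : ℕ) :
    Integrable (fun z : Noise m M N => ‖z‖ ^ 2) (noiseLaw m M N) := by
  have h (ι : Type) [Fintype ι] : Integrable (fun z : ι → Slot m → ℂ => ‖z‖ ^ 2)
      (Measure.pi fun _ => Measure.pi fun _ => stdCN) :=
    integrable_sq_norm_pi (integrable_sq_norm_pi integrable_sq_norm_stdCN)
  refine (((h (Fin M)).comp_fst _).add ((h (Fin N)).comp_snd _)).mono' (by fun_prop)
    (Eventually.of_forall fun z => ?_)
  rw [Real.norm_of_nonneg (by positivity), Prod.norm_def]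
  rcases max_cases ‖z.1‖ ‖z.2‖ with h | h <;> rw [h.1] <;> simp

/-! ### The probability that one source is nearly aligned with the others -/

/-- The matrix whose first `n` columns are the vectors `F k`, and whose other columns are those of
the identity matrix. -/
def extendColumns {M n : ℕ} (F : Fin n → Fin M → ℂ) : Matrix (Fin M) (Fin M) ℂ :=
  Matrix.of fun i l => if h : l.val < n then F ⟨l, h⟩ i else (1 : Matrix (Fin M) (Fin M) ℂ) i l

lemma continuous_extendColumns {M n : ℕ} :
    Continuous (extendColumns : (Fin n → Fin M → ℂ) → Matrix (Fin M) (Fin M) ℂ) := by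
  refine continuous_matrix fun i l => ?_
  by_cases h : l.val < n
  · simp only [extendColumns, Matrix.of_apply, h, dite_true]
    fun_prop
  · simp only [extendColumns, Matrix.of_apply, h, dite_false]
    fun_prop

/-- The vectors near the span of the `F k`: up to an error `δ` in each coordinate. -/
def nearSpan {M n : ℕ} (δ : ℝ) (F : Fin n → Fin M → ℂ) : Set (Fin M → ℂ) :=
  {x | ∃ c : Fin n → ℂ, ∀ i, ‖x i - ∑ k, c k * F k i‖ < δ}

/-- The volume of the `δ`-neighbourhood of a span of `n` vectors within a fixed ball, bounded below
by that of the image of the unit ball under the linear map that stretches by the vectors `F k` in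
`n` directions and by `δ` in all others. -/
lemma le_volume_nearSpan {M n : ℕ} (hn : n ≤ M) {δ : ℝ} (hδ : 0 < δ) (hδ1 : δ ≤ 1)
    {F : Fin n → Fin M → ℂ} (hF : ‖F‖ < 2) :
    ENNReal.ofReal (δ ^ (2 * (M - n)) * ‖(extendColumns F).det‖ ^ 2) *
      volume (ball (0 : Fin M → ℂ) 1) ≤
      volume (nearSpan δ F ∩ ball 0 (2 * n + 2)) := by
  -- the determinant over `ℝ` is the squared modulus of the one over `ℂ`, hence the exponent
  let D : Fin M → ℂ := fun l => if l.val < n then 1 else δ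
  let A : Matrix (Fin M) (Fin M) ℂ := extendColumns F * Matrix.diagonal D
  let T : (Fin M → ℂ) →ₗ[ℝ] (Fin M → ℂ) := (Matrix.toLin' A).restrictScalars ℝ
  have hdet : |LinearMap.det T| = δ ^ (2 * (M - n)) * ‖(extendColumns F).det‖ ^ 2 := by
    have hD : ∏ l, D l = (δ : ℂ) ^ (M - n) := by
      simp only [D]
      rw [Finset.prod_ite]
      simp only [Finset.prod_const, one_pow, one_mul]
      congr 1
      rw [Finset.filter_not, Finset.card_sdiff_of_subset (Finset.filter_subset _ _),
        Finset.card_univ, Fintype.card_fin, Fin.card_filter_val_lt, min_eq_right hn]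
    rw [LinearMap.det_restrictScalars, Algebra.norm_complex_apply, LinearMap.det_toLin',
      Matrix.det_mul, Matrix.det_diagonal, hD, Complex.normSq_eq_norm_sq,
      abs_of_nonneg (sq_nonneg _), norm_mul, mul_pow, norm_pow, Complex.norm_real, Real.norm_of_nonneg hδ.le, ← pow_mul,
      mul_comm (M - n), mul_comm]
  rw [← hdet, ← Measure.addHaar_image_linearMap]
  refine measure_mono ?_
  rintro _ ⟨y, hy, rfl⟩
  have hy' (i) : ‖y i‖ < 1 := (norm_le_pi_norm y i).trans_lt (by simpa using hy)
  have hT (i : Fin M) : T y i = ∑ k, y (Fin.castLE hn k) * F k i +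
      if i.val < n then 0 else δ * y i := by
    change (A *ᵥ y) i = _
    simp only [Matrix.mulVec, dotProduct, A, Matrix.mul_diagonal, D, extendColumns,
      Matrix.of_apply]
    obtain ⟨r, rfl⟩ := Nat.exists_eq_add_of_le hn
    rw [Fin.sum_univ_add]
    congr 1
    · simp [mul_comm, Fin.castAdd]
    · simp only [Fin.val_natAdd, Nat.not_lt.2 (Nat.le_add_right _ _), dite_false, if_false]
      refine Fin.addCases (fun k => ?_) (fun l => ?_) i
      · refine (Finset.sum_eq_zero fun l _ => ?_).trans (by simp)
        rw [Matrix.one_apply_ne, zero_mul, zero_mul]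
        intro h
        have := congrArg Fin.val h
        simp only [Fin.val_castAdd, Fin.val_natAdd] at this
        omega
      · simp [Matrix.one_apply]
  refine ⟨⟨fun k => y (Fin.castLE hn k), fun i => ?_⟩, ?_⟩
  · rw [hT, add_sub_cancel_left]
    split_ifs
    · simpa using hδ
    · rw [norm_mul, Complex.norm_real, Real.norm_of_nonneg hδ.le]
      have := hy' i
      nlinarith
  · rw [mem_ball_zero_iff, pi_norm_lt_iff (by positivity)]
    intro i
    rw [hT]
    have h1 : ‖∑ k, y (Fin.castLE hn k) * F k i‖ ≤ ∑ _k : Fin n, (2 : ℝ) := by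
      refine norm_sum_le_of_le _ fun k _ => ?_
      have h2 := norm_le_pi_norm (F k) i
      have h3 := norm_le_pi_norm F k
      have h4 := (hy' (Fin.castLE hn k)).le
      rw [norm_mul]
      nlinarith [norm_nonneg (F k i)]
    have h2 : ‖if i.val < n then 0 else δ * y i‖ ≤ 1 := by
      split_ifs
      · simp
      · rw [norm_mul, Complex.norm_real, Real.norm_of_nonneg hδ.le]
        have := hy' i
        nlinarith [norm_nonneg (y i)]
    simp only [Finset.sum_const, Finset.card_univ, Fintype.card_fin, nsmul_eq_mul] at h1
    exact (norm_add_le _ _).trans_lt (by linarith)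

/-- The channels for which the vector of Source `j₀` to the relay is within `δ`, in each
coordinate, of a linear combination of the vectors of the other sources, and for which the
coefficients from the relay to the destination are bounded by `1`. -/
def alignedChannels {J M : ℕ} (N : ℕ) (j₀ : Fin J) (δ : ℝ) : Set (Channel J M N) :=
  {ch | (∃ c : Fin J → ℂ, ∀ i, ‖ch.1 j₀ i - ∑ j with j ≠ j₀, c j * ch.1 j i‖ < δ) ∧
    ∀ i n, ‖ch.2 i n‖ < 1}

lemma isOpen_alignedChannels {J M N : ℕ} (j₀ : Fin J) (δ : ℝ) :
    IsOpen (alignedChannels N j₀ δ : Set (Channel J M N)) := by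
  simp only [alignedChannels, Set.ofPred_and, Set.ofPred_exists, Set.ofPred_forall]
  refine (isOpen_iUnion fun c => isOpen_iInter_of_finite fun i => ?_).inter
    (isOpen_iInter_of_finite fun i => isOpen_iInter_of_finite fun n => ?_) <;>
  exact isOpen_lt (by fun_prop) (by fun_prop)

lemma isOpen_nearSpan {M n : ℕ} (δ : ℝ) :
    IsOpen {p : (Fin M → ℂ) × (Fin n → Fin M → ℂ) | p.1 ∈ nearSpan δ p.2} := by
  change IsOpen {p : (Fin M → ℂ) × (Fin n → Fin M → ℂ) |
    ∃ c : Fin n → ℂ, ∀ i, ‖p.1 i - ∑ k, c k * p.2 k i‖ < δ}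
  simp only [Set.ofPred_exists, Set.ofPred_forall]
  refine isOpen_iUnion fun c => isOpen_iInter_of_finite fun i => ?_
  exact isOpen_lt (by fun_prop) (by fun_prop)

/-- Given vectors of the other sources in an open set on which `extendColumns` has a determinant
bounded away from `0`, the vector of Source `j₀` falls near their span with probability at least of
order `δ ^ (2 * (M - J + 1))`. -/
theorem exists_le_channelLaw_alignedChannels {J M : ℕ} (N : ℕ) (hJM : J ≤ M) (j₀ : Fin J) :
    ∃ c : ℝ, 0 < c ∧ ∀ δ : ℝ, 0 < δ → δ ≤ 1 →
      ENNReal.ofReal (c * δ ^ (2 * (M - J + 1))) ≤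
        channelLaw J M N (alignedChannels N j₀ δ) := by
  obtain _ | n := J
  · exact j₀.elim0
  set ν : Measure (Fin M → ℂ) := Measure.pi fun _ => stdCN with hν
  have hνd : DominatesVolume ν := dominatesVolume_stdCN.pi
  let U : Set (Fin n → Fin M → ℂ) := {F | 1 / 2 < ‖(extendColumns F).det‖ ^ 2} ∩ ball 0 2
  have hU : IsOpen U := by
    refine IsOpen.inter (isOpen_lt continuous_const ?_) isOpen_ball
    exact (continuous_extendColumns.matrix_det).norm.pow 2
  have hUne : U.Nonempty := by
    refine ⟨fun k i => (1 : Matrix (Fin M) (Fin M) ℂ) i (Fin.castLE (by omega) k), ?_, ?_⟩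
    · have : extendColumns (fun k i => (1 : Matrix (Fin M) (Fin M) ℂ) i
          (Fin.castLE (show n ≤ M by omega) k)) = 1 := by
        ext i l
        simp only [extendColumns, Matrix.of_apply]
        split_ifs <;> rfl
      simp only [Set.mem_ofPred_eq, this]
      norm_num
    · rw [mem_ball_zero_iff]
      refine lt_of_le_of_lt (b := (1 : ℝ)) ?_ one_lt_two
      refine (pi_norm_le_iff_of_nonneg zero_le_one).2 fun k =>
        (pi_norm_le_iff_of_nonneg zero_le_one).2 fun i => ?_
      rw [Matrix.one_apply]
      split_ifs <;> simp
  obtain ⟨κ, hκ, hκν⟩ := hνd (2 * n + 2)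
  have hslice {δ : ℝ} (hδ : 0 < δ) (hδ1 : δ ≤ 1) {F : Fin n → Fin M → ℂ} (hF : F ∈ U) :
      κ * (ENNReal.ofReal (δ ^ (2 * (M - n)) * (1 / 2)) * volume (ball (0 : Fin M → ℂ) 1)) ≤
        ν (nearSpan δ F) := by
    refine le_trans ?_ (hκν _)
    rw [Measure.smul_apply, ENNReal.smul_def, smul_eq_mul]
    refine mul_le_mul_right (le_trans ?_ (Measure.le_restrict_apply _ _)) _
    refine le_trans ?_ (le_volume_nearSpan (by omega) hδ hδ1 (by simpa using hF.2))
    gcongr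
    exact hF.1.le
  let G : Set (Fin M → Fin N → ℂ) := {g | ∀ i n, ‖g i n‖ < 1}
  have hG : 0 < (Measure.pi fun _ : Fin M => Measure.pi fun _ : Fin N => stdCN) G := by
    refine dominatesVolume_stdCN.pi.pi.pos_of_isOpen ?_ ⟨0, by simp [G]⟩
    simp only [G, Set.ofPred_forall]
    exact isOpen_iInter_of_finite fun i => isOpen_iInter_of_finite fun n =>
      isOpen_lt (by fun_prop) (by fun_prop)
  have hUpos : 0 < (Measure.pi fun _ : Fin n => ν) U := hνd.pi.pos_of_isOpen hU hUne
  let c : ℝ≥0∞ := κ * ENNReal.ofReal (1 / 2) * volume (ball (0 : Fin M → ℂ) 1) *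
    (Measure.pi fun _ : Fin n => ν) U *
    (Measure.pi fun _ : Fin M => Measure.pi fun _ : Fin N => stdCN) G
  have hball : volume (ball (0 : Fin M → ℂ) 1) ≠ ⊤ := measure_ball_lt_top.ne
  have hball0 : volume (ball (0 : Fin M → ℂ) 1) ≠ 0 := (measure_ball_pos _ _ one_pos).ne'
  have hc : c ≠ ⊤ := by finiteness
  have hc0 : c ≠ 0 := by simp [c, hκ, hball0, hUpos.ne', hG.ne']
  refine ⟨c.toReal, ENNReal.toReal_pos hc0 hc, fun δ hδ hδ1 => ?_⟩
  have hset : (alignedChannels N j₀ δ : Set (Channel (n + 1) M N)) =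
      (MeasurableEquiv.piFinSuccAbove (fun _ => Fin M → ℂ) j₀ ⁻¹'
        {p | p.1 ∈ nearSpan δ p.2}) ×ˢ G := by
    ext ch
    simp only [alignedChannels, Set.mem_prod, Set.mem_preimage, Set.mem_ofPred_eq, nearSpan, G]
    refine and_congr_left fun _ => ?_
    have hsum (c : Fin (n + 1) → ℂ) (i : Fin M) :
        ∑ j with j ≠ j₀, c j * ch.1 j i =
          ∑ k, c (j₀.succAbove k) * ch.1 (j₀.succAbove k) i := by
      rw [Finset.sum_filter, Fin.sum_univ_succAbove _ j₀]
      simp [Fin.succAbove_ne]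
    simp only [hsum]
    constructor
    · rintro ⟨c, h⟩
      exact ⟨fun k => c (j₀.succAbove k), h⟩
    · rintro ⟨c, h⟩
      refine ⟨j₀.insertNth 0 c, fun i => ?_⟩
      simp only [Fin.insertNth_apply_succAbove]
      exact h i
  rw [hset, channelLaw, Measure.prod_prod,
    (measurePreserving_piFinSuccAbove (fun _ => ν) j₀).measure_preimage_equiv,
    Measure.prod_apply_symm (isOpen_nearSpan δ).measurableSet]
  have hint : κ * (ENNReal.ofReal (δ ^ (2 * (M - n)) * (1 / 2)) *
      volume (ball (0 : Fin M → ℂ) 1)) * (Measure.pi fun _ : Fin n => ν) U ≤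
      ∫⁻ F, ν ((fun x => (x, F)) ⁻¹' {p : (Fin M → ℂ) × (Fin n → Fin M → ℂ) |
        p.1 ∈ nearSpan δ p.2}) ∂(Measure.pi fun _ : Fin n => ν) := by
    rw [← setLIntegral_const]
    exact (setLIntegral_mono_ae' hU.measurableSet
      (Eventually.of_forall fun F hF => hslice hδ hδ1 hF)).trans (setLIntegral_le_lintegral _ _)
  refine le_trans (le_of_eq ?_) (mul_le_mul_left hint _)
  have he : M - (n + 1) + 1 = M - n := by omega
  rw [he, ENNReal.ofReal_mul (by positivity), ENNReal.ofReal_toReal hc,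
    ENNReal.ofReal_mul (by positivity)]
  simp only [c]
  ring

/-! ### Zero forcing -/

/-- The matrices of quaternion form, that is, of the form of the Alamouti code. -/
def IsAlamouti (A : Matrix (Fin 2) (Fin 2) ℂ) : Prop :=
  A 1 1 = conj (A 0 0) ∧ A 0 1 = -conj (A 1 0)

namespace IsAlamouti

variable {A B : Matrix (Fin 2) (Fin 2) ℂ}

lemma zero : IsAlamouti 0 := by simp [IsAlamouti]

lemma one : IsAlamouti 1 := by simp [IsAlamouti]

lemma mul (hA : IsAlamouti A) (hB : IsAlamouti B) : IsAlamouti (A * B) := by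
  obtain ⟨h1, h2⟩ := hA
  obtain ⟨h3, h4⟩ := hB
  constructor <;>
  · simp only [Matrix.mul_apply, Fin.sum_univ_two, h1, h2, h3, h4, map_add, map_mul, map_neg,
      Complex.conj_conj]
    ring

lemma conjTranspose (hA : IsAlamouti A) : IsAlamouti Aᴴ := by
  obtain ⟨h1, h2⟩ := hA
  constructor <;> simp [Matrix.conjTranspose_apply, h1, h2]

lemma sub (hA : IsAlamouti A) (hB : IsAlamouti B) : IsAlamouti (A - B) := by
  obtain ⟨h1, h2⟩ := hA
  obtain ⟨h3, h4⟩ := hB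
  constructor
  · simp [h1, h3]
  · simp only [Matrix.sub_apply, h2, h4, map_sub]
    ring

lemma smul (hA : IsAlamouti A) (r : ℝ) : IsAlamouti ((r : ℂ) • A) := by
  obtain ⟨h1, h2⟩ := hA
  constructor <;> simp [h1, h2]

lemma sum {ι : Type*} {s : Finset ι} {f : ι → Matrix (Fin 2) (Fin 2) ℂ}
    (h : ∀ i, IsAlamouti (f i)) : IsAlamouti (∑ i ∈ s, f i) := by
  constructor
  · simp [Matrix.sum_apply, (h _).1]
  · simp [Matrix.sum_apply, (h _).2]

/-- The columns of an Alamouti matrix are orthogonal and of equal norm. -/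
lemma conjTranspose_mul_self (hA : IsAlamouti A) :
    Aᴴ * A = (frobSq A / 2 : ℂ) • (1 : Matrix (Fin 2) (Fin 2) ℂ) := by
  obtain ⟨h1, h2⟩ := hA
  have h (z : ℂ) : ((‖z‖ ^ 2 : ℝ) : ℂ) = conj z * z := by
    rw [← Complex.normSq_eq_norm_sq, Complex.normSq_eq_conj_mul_self]
  have hf : (frobSq A : ℂ) / 2 = conj (A 0 0) * A 0 0 + conj (A 1 0) * A 1 0 := by
    simp only [frobSq, Fin.sum_univ_two, Complex.ofReal_add, h, h1, h2, map_neg, Complex.conj_conj]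
    ring
  rw [hf]
  ext a b
  fin_cases a <;> fin_cases b <;>
    simp [Matrix.mul_apply, Fin.sum_univ_two, Matrix.conjTranspose_apply, h1, h2] <;> ring

lemma icStep {En Ep X Y : Matrix (Fin 2) (Fin 2) ℂ} (hn : IsAlamouti En) (hp : IsAlamouti Ep)
    (hX : IsAlamouti X) (hY : IsAlamouti Y) : IsAlamouti (icStep En Ep X Y) := by
  have := (((hn.conjTranspose.mul hX).smul (frobSq Ep)).sub
    ((hp.conjTranspose.mul hY).smul (frobSq En))).smul (2 / (frobSq En * frobSq Ep))
  simpa [MARN.icStep] using this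

end IsAlamouti

lemma isAlamouti_eqChannel {m J M N : ℕ} (col : Fin M → Slot m) (ch : Channel J M N)
    (u : Fin m → ZMod 2) (n : Fin N) (j : Fin J) : IsAlamouti (eqChannel col ch u n j) := by
  simp [IsAlamouti, eqChannel]

lemma isAlamouti_icFilter {J N : ℕ} {H : Fin N → Fin J → Matrix (Fin 2) (Fin 2) ℂ}
    (hH : ∀ n j, IsAlamouti (H n j)) (l : List (Fin J)) (n : ℕ) (n' : Fin N) :
    IsAlamouti (icFilter H l n n') := by
  induction l generalizing n n' with
  | nil =>
    rw [icFilter]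
    split_ifs
    exacts [.one, .zero]
  | cons j l ih =>
    exact .icStep (.sum fun _ => (ih _ _).mul (hH _ _)) (.sum fun _ => (ih _ _).mul (hH _ _))
      (ih _ _) (ih _ _)

lemma sum_icStep_mul {ι : Type*} (s : Finset ι) (En Ep : Matrix (Fin 2) (Fin 2) ℂ)
    (X Y B : ι → Matrix (Fin 2) (Fin 2) ℂ) :
    ∑ i ∈ s, icStep En Ep (X i) (Y i) * B i =
      icStep En Ep (∑ i ∈ s, X i * B i) (∑ i ∈ s, Y i * B i) := by
  simp only [icStep, smul_mul_assoc, sub_mul, ← Finset.smul_sum, Finset.sum_sub_distrib,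
    Finset.mul_sum, mul_assoc]

/-- A step of interference cancellation annihilates the source that it is aimed at. -/
lemma icStep_self {En Ep : Matrix (Fin 2) (Fin 2) ℂ} (hn : IsAlamouti En) (hp : IsAlamouti Ep) :
    icStep En Ep En Ep = 0 := by
  rw [icStep, hn.conjTranspose_mul_self, hp.conjTranspose_mul_self, smul_smul, smul_smul,
    ← sub_smul]
  simp [mul_div_assoc', mul_comm]

/-- All sources in the list are cancelled. -/
lemma sum_icFilter_mul {J N : ℕ} {H : Fin N → Fin J → Matrix (Fin 2) (Fin 2) ℂ}
    (hH : ∀ n j, IsAlamouti (H n j)) {l : List (Fin J)} {j : Fin J} (hj : j ∈ l) (n : ℕ) :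
    ∑ n', icFilter H l n n' * H n' j = 0 := by
  induction l generalizing n with
  | nil => simp at hj
  | cons i l ih =>
    simp only [icFilter]
    rw [sum_icStep_mul]
    rcases List.mem_cons.1 hj with rfl | hj
    · exact icStep_self (.sum fun _ => (isAlamouti_icFilter hH _ _ _).mul (hH _ _))
        (.sum fun _ => (isAlamouti_icFilter hH _ _ _).mul (hH _ _))
    · simp [ih hj, icStep]

/-! ### The received signal in the Alamouti systems -/

lemma sgn_add {m : ℕ} (u s t : Fin m → ZMod 2) : sgn u (s + t) = sgn u s * sgn u t := by
  simp only [sgn, ← Finset.prod_mul_distrib]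
  refine Finset.prod_congr rfl fun l _ => ?_
  have h (a b c : ZMod 2) : (if a = 1 ∧ b + c = 1 then (-1 : ℤ) else 1) =
      (if a = 1 ∧ b = 1 then -1 else 1) * (if a = 1 ∧ c = 1 then -1 else 1) := by
    revert a b c; decide
  exact_mod_cast h (u l) (s l) (t l)

lemma conj_sgn {m : ℕ} (u t : Fin m → ZMod 2) : conj (sgn u t) = sgn u t := by
  simp only [sgn, map_prod]
  refine Finset.prod_congr rfl fun l _ => ?_
  split_ifs <;> simp

lemma sum_sgn_mul_shift {m : ℕ} (u κ : Fin m → ZMod 2) (c : ℂ) (r : (Fin m → ZMod 2) → ℂ) :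
    ∑ t, sgn u t * (c * r (t + κ)) = sgn u κ * c * ∑ t, sgn u t * r t := by
  rw [Finset.mul_sum, ← Equiv.sum_comp (Equiv.addRight κ) fun t => sgn u κ * c * (sgn u t * r t)]
  refine Finset.sum_congr rfl fun t _ => ?_
  have h : sgn u κ * sgn u κ = 1 := by
    rw [← sgn_add, show κ + κ = 0 from funext fun l => CharTwo.add_self_eq_zero _]
    simp [sgn]
  rw [Equiv.coe_addRight, sgn_add]
  linear_combination (-sgn u t * c * r (t + κ)) * h

/-- The signal at the destination antennas that results from a source with channel vector `a` to
the relay and symbols `r`, without noise and power factors. -/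
def relaySignal {m M N : ℕ} (col : Fin M → Slot m) (g : Fin M → Fin N → ℂ) (a : Fin M → ℂ)
    (r : Slot m → ℂ) (n : Fin N) (τ : Slot m) : ℂ :=
  ∑ i, g i n * codeColumn (col i) (fun σ => a i * r σ) τ

lemma separate_relaySignal {m J M N : ℕ} (col : Fin M → Slot m) (ch : Channel J M N) (j : Fin J)
    (r : Slot m → ℂ) (n : Fin N) (u : Fin m → ZMod 2) :
    separate (relaySignal col ch.2 (ch.1 j) r n) u =
      eqChannel col ch u n j *ᵥ separate r u := by
  have h0 (i : Fin M) : ∑ t, sgn u t * codeColumn (col i) (fun σ => ch.1 j i * r σ) (0, t) =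
      if (col i).1 = 0 then sgn u (col i).2 * ch.1 j i * ∑ t, sgn u t * r (0, t)
      else -(sgn u (col i).2 * conj (ch.1 j i) * ∑ t, sgn u t * conj (r (1, t))) := by
    simp only [codeColumn]
    split_ifs
    · exact sum_sgn_mul_shift u _ _ fun t => r (0, t)
    · simp only [mul_neg, Finset.sum_neg_distrib, map_mul]
      rw [sum_sgn_mul_shift u _ _ fun t => conj (r (1, t))]
  have h1 (i : Fin M) : ∑ t, sgn u t * codeColumn (col i) (fun σ => ch.1 j i * r σ) (1, t) =
      if (col i).1 = 0 then sgn u (col i).2 * ch.1 j i * ∑ t, sgn u t * r (1, t)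
      else sgn u (col i).2 * conj (ch.1 j i) * ∑ t, sgn u t * conj (r (0, t)) := by
    simp only [codeColumn, one_ne_zero, if_false]
    split_ifs
    · exact sum_sgn_mul_shift u _ _ fun t => r (1, t)
    · simp only [map_mul]
      rw [sum_sgn_mul_shift u _ _ fun t => conj (r (0, t))]
  have hsum (a : Fin 2) : ∑ t, sgn u t * relaySignal col ch.2 (ch.1 j) r n (a, t) =
      ∑ i, ch.2 i n * ∑ t, sgn u t * codeColumn (col i) (fun σ => ch.1 j i * r σ) (a, t) := by
    simp only [relaySignal, Finset.mul_sum]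
    rw [Finset.sum_comm]
    simp only [mul_left_comm]
  ext a
  fin_cases a
  · simp only [separate, hsum, h0, eqChannel]
    simp [Matrix.mulVec, dotProduct, Fin.sum_univ_two, Finset.sum_mul, conj_sgn,
      apply_ite conj]
    rw [← sub_eq_add_neg, ← Finset.sum_sub_distrib]
    refine Finset.sum_congr rfl fun i _ => ?_
    split_ifs <;> ring
  · simp only [separate, hsum, h1, eqChannel]
    simp [Matrix.mulVec, dotProduct, Fin.sum_univ_two, Finset.sum_mul, conj_sgn,
      apply_ite conj]
    rw [← Finset.sum_add_distrib]
    refine Finset.sum_congr rfl fun i _ => ?_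
    split_ifs <;> simp <;> ring

lemma codeColumn_add {m : ℕ} (κ : Slot m) (r r' : Slot m → ℂ) (τ : Slot m) :
    codeColumn κ (fun σ => r σ + r' σ) τ = codeColumn κ r τ + codeColumn κ r' τ := by
  simp only [codeColumn]
  split_ifs <;> simp [add_comm]

lemma codeColumn_smul {m : ℕ} (κ : Slot m) (x : ℝ) (r : Slot m → ℂ) (τ : Slot m) :
    codeColumn κ (fun σ => x * r σ) τ = x * codeColumn κ r τ := by
  simp only [codeColumn]
  split_ifs <;> simp

lemma norm_codeColumn_le {m : ℕ} (κ : Slot m) {r : Slot m → ℂ} {B : ℝ} (h : ∀ σ, ‖r σ‖ ≤ B)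
    (τ : Slot m) : ‖codeColumn κ r τ‖ ≤ B := by
  simp only [codeColumn]
  split_ifs <;> simpa using h _

lemma relaySignal_add {m M N : ℕ} (col : Fin M → Slot m) (g : Fin M → Fin N → ℂ)
    (a b : Fin M → ℂ) (r : Slot m → ℂ) :
    relaySignal col g (fun i => a i + b i) r = relaySignal col g a r + relaySignal col g b r := by
  ext n τ
  simp [relaySignal, add_mul, codeColumn_add, mul_add, Finset.sum_add_distrib]

lemma relaySignal_sum {m M N : ℕ} {ι : Type*} (col : Fin M → Slot m) (g : Fin M → Fin N → ℂ)
    (s : Finset ι) (a : ι → Fin M → ℂ) (r : Slot m → ℂ) :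
    relaySignal col g (fun i => ∑ j ∈ s, a j i) r = ∑ j ∈ s, relaySignal col g (a j) r := by
  classical
  induction s using Finset.induction_on with
  | empty => ext n τ; simp [relaySignal, codeColumn]
  | insert j s hj ih => simp only [Finset.sum_insert hj, relaySignal_add, ih]

lemma norm_relaySignal_le {m M N : ℕ} (col : Fin M → Slot m) {g : Fin M → Fin N → ℂ}
    (hg : ∀ i n, ‖g i n‖ ≤ 1) {a : Fin M → ℂ} {δ : ℝ} (hδ : 0 ≤ δ) (ha : ∀ i, ‖a i‖ ≤ δ)
    {r : Slot m → ℂ} {ρ : ℝ} (hρ : 0 ≤ ρ) (hr : ∀ σ, ‖r σ‖ ≤ ρ) :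
    ‖relaySignal col g a r‖ ≤ M * (δ * ρ) := by
  refine (pi_norm_le_iff_of_nonneg (by positivity)).2 fun n =>
    (pi_norm_le_iff_of_nonneg (by positivity)).2 fun τ => ?_
  calc ‖relaySignal col g a r n τ‖ ≤ ∑ _i : Fin M, 1 * (δ * ρ) := by
        refine norm_sum_le_of_le _ fun i _ => ?_
        rw [norm_mul]
        gcongr
        · exact hg i n
        · refine norm_codeColumn_le _ (fun σ => ?_) _
          rw [norm_mul]
          gcongr
          exacts [ha i, hr σ]
    _ = _ := by simp

/-! ### The observation after interference cancellation -/

section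

variable {m J M N : ℕ} (col : Fin M → Slot m) (ch : Channel J M N) (j₀ : Fin J)

lemma afterIC_add (x y : Fin N → Slot m → ℂ) :
    afterIC col ch j₀ (x + y) = afterIC col ch j₀ x + afterIC col ch j₀ y := by
  have h (n : Fin N) (u : Fin m → ZMod 2) :
      separate (x n + y n) u = separate (x n) u + separate (y n) u := by
    ext a
    fin_cases a <;> simp [separate, mul_add, Finset.sum_add_distrib]
  ext o
  simp only [afterIC, h, Matrix.mulVec_add, Finset.sum_add_distrib, Pi.add_apply]

lemma afterIC_smul (c : ℝ) (x : Fin N → Slot m → ℂ) :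
    afterIC col ch j₀ (c • x) = c • afterIC col ch j₀ x := by
  have h (n : Fin N) (u : Fin m → ZMod 2) :
      separate (c • x n) u = (c : ℂ) • separate (x n) u := by
    ext a
    fin_cases a <;> simp [separate, mul_left_comm _ (c : ℂ), Finset.mul_sum]
  ext o
  simp only [afterIC, h, Matrix.mulVec_smul, ← Finset.smul_sum, Pi.smul_apply, smul_eq_mul,
    Complex.real_smul]

/-- Separation and interference cancellation, as a real-linear map. -/
noncomputable def afterICLinear : (Fin N → Slot m → ℂ) →ₗ[ℝ] ObsIdx m J N → ℂ where
  toFun := afterIC col ch j₀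
  map_add' := afterIC_add col ch j₀
  map_smul' := afterIC_smul col ch j₀

lemma afterIC_relaySignal (j : Fin J) (r : Slot m → ℂ) (o : ObsIdx m J N) :
    afterIC col ch j₀ (relaySignal col ch.2 (ch.1 j) r) o =
      ((∑ n', icFilter (eqChannel col ch o.1) (interferers j₀) o.2.1 n' *
        eqChannel col ch o.1 n' j) *ᵥ separate r o.1) o.2.2 := by
  simp only [afterIC, separate_relaySignal, Matrix.mulVec_mulVec, Matrix.sum_mulVec]

lemma afterIC_relaySignal_of_ne {j : Fin J} (hj : j ≠ j₀) (r : Slot m → ℂ) :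
    afterIC col ch j₀ (relaySignal col ch.2 (ch.1 j) r) = 0 := by
  ext o
  rw [afterIC_relaySignal, sum_icFilter_mul (fun n j => isAlamouti_eqChannel col ch o.1 n j)
    (by simpa [interferers] using hj)]
  simp

/-- Zero forcing cannot tell the channel vector of Source `j₀` from its remainder modulo the
channel vectors of the sources that are cancelled. -/
lemma afterIC_relaySignal_sub_sum (c : Fin J → ℂ) (r : Slot m → ℂ) :
    afterIC col ch j₀ (relaySignal col ch.2 (ch.1 j₀) r) =
      afterIC col ch j₀ (relaySignal col ch.2
        (fun i => ch.1 j₀ i - ∑ j with j ≠ j₀, c j * ch.1 j i) r) := by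
  have h : relaySignal col ch.2 (ch.1 j₀) r =
      relaySignal col ch.2 (fun i => ch.1 j₀ i - ∑ j with j ≠ j₀, c j * ch.1 j i) r +
        ∑ j with j ≠ j₀, relaySignal col ch.2 (ch.1 j) (fun σ => c j * r σ) := by
    have h1 (j : Fin J) : relaySignal col ch.2 (ch.1 j) (fun σ => c j * r σ) =
        relaySignal col ch.2 (fun i => c j * ch.1 j i) r := by
      ext n τ
      simp only [relaySignal, mul_left_comm (ch.1 j _), mul_assoc]
    simp only [h1]
    rw [← relaySignal_sum, ← relaySignal_add]
    simp
  rw [h, afterIC_add]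
  change _ + afterICLinear col ch j₀ _ = _
  rw [map_sum, Finset.sum_eq_zero, add_zero]
  intro j hj
  exact afterIC_relaySignal_of_ne col ch j₀ (by simpa using hj) _

lemma channelVector_eq_afterIC (k : Slot m) :
    channelVector col ch j₀ k =
      afterIC col ch j₀ (relaySignal col ch.2 (ch.1 j₀) (Pi.single k 1)) := by
  obtain ⟨a, t⟩ := k
  ext o
  have h : separate (Pi.single (a, t) (1 : ℂ)) o.1 = Pi.single a (sgn o.1 t) := by
    ext b
    fin_cases a <;> fin_cases b <;>
      simp [separate, Pi.single_apply, Prod.ext_iff, conj_sgn]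
  rw [afterIC_relaySignal, h, channelVector, Matrix.mulVec_single]
  simp [mul_comm]

lemma destReceived_eq (P : ℝ) (s : Fin J → Slot m → ℂ) (z : Noise m M N) :
    destReceived col P ch s z = (√P * relayGain J M P) •
      ∑ j, relaySignal col ch.2 (ch.1 j) (s j) + destReceived col P ch 0 z := by
  ext n τ
  have h1 (i : Fin M) : codeColumn (col i) (relayReceived P ch s z.1 i) τ =
      √P * ∑ j, codeColumn (col i) (fun σ => ch.1 j i * s j σ) τ +
        codeColumn (col i) (relayReceived P ch 0 z.1 i) τ := by
    have h2 : ∑ j, codeColumn (col i) (fun σ => ch.1 j i * s j σ) τ =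
        codeColumn (col i) (fun σ => ∑ j, ch.1 j i * s j σ) τ := by
      simp only [codeColumn]
      split_ifs <;> simp
    rw [h2, ← codeColumn_smul, ← codeColumn_add]
    congr 1
    ext σ
    simp [relayReceived]
  simp only [destReceived, h1, Pi.add_apply, Pi.smul_apply, Finset.sum_apply, relaySignal,
    mul_add, Finset.sum_add_distrib, Complex.real_smul, Complex.ofReal_mul, Finset.mul_sum,
    ← add_assoc]
  rw [Finset.sum_comm]
  congr 2
  refine Finset.sum_congr rfl fun j _ => Finset.sum_congr rfl fun i _ => ?_
  ring

lemma destReceived_zero_add (P : ℝ) (z z' : Noise m M N) :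
    destReceived col P ch 0 (z + z') = destReceived col P ch 0 z + destReceived col P ch 0 z' := by
  ext n τ
  have h (i : Fin M) : relayReceived P ch 0 (z + z').1 i =
      fun σ => relayReceived P ch 0 z.1 i σ + relayReceived P ch 0 z'.1 i σ := by
    ext σ
    simp [relayReceived]
  simp only [destReceived, h, codeColumn_add, mul_add, Finset.sum_add_distrib, Prod.snd_add,
    Pi.add_apply]
  ring

lemma destReceived_zero_smul (P : ℝ) (c : ℝ) (z : Noise m M N) :
    destReceived col P ch 0 (c • z) = c • destReceived col P ch 0 z := by
  ext n τ
  have h (i : Fin M) : relayReceived P ch 0 (c • z).1 i =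
      fun σ => c * relayReceived P ch 0 z.1 i σ := by
    ext σ
    simp [relayReceived]
  simp only [destReceived, h, codeColumn_smul, Prod.smul_snd, Pi.smul_apply, Complex.real_smul,
    mul_add, Finset.mul_sum]
  congr 1
  exact Finset.sum_congr rfl fun i _ => by ring

lemma destReceived_zero_noise (P : ℝ) (η : Fin N → Slot m → ℂ) :
    destReceived col P ch 0 ((0, η) : Noise m M N) = η := by
  ext n τ
  simp [destReceived, relayReceived, codeColumn]

/-- The noise that is left after interference cancellation, as a real-linear function of all
noises. -/
noncomputable def noiseLinear (P : ℝ) : Noise m M N →ₗ[ℝ] ObsIdx m J N → ℂ where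
  toFun := observation col P ch j₀ 0
  map_add' z z' := by rw [observation, destReceived_zero_add, afterIC_add]; rfl
  map_smul' c z := by rw [observation, destReceived_zero_smul, afterIC_smul]; rfl

lemma noiseLinear_apply (P : ℝ) (z : Noise m M N) :
    noiseLinear col ch j₀ P z = observation col P ch j₀ 0 z := rfl

/-- Any vector of signals at the destination is also a possible value of the destination's own
noise. -/
lemma noiseLinear_dest (P : ℝ) (η : Fin N → Slot m → ℂ) :
    noiseLinear col ch j₀ P (0, η) = afterIC col ch j₀ η := by
  rw [noiseLinear_apply, observation, destReceived_zero_noise]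

lemma observation_eq (P : ℝ) (s : Fin J → Slot m → ℂ) (z : Noise m M N) :
    observation col P ch j₀ s z = (√P * relayGain J M P) •
      afterIC col ch j₀ (relaySignal col ch.2 (ch.1 j₀) (s j₀)) +
        observation col P ch j₀ 0 z := by
  rw [observation, destReceived_eq, afterIC_add, afterIC_smul]
  congr 2
  change afterICLinear col ch j₀ _ = _
  rw [map_sum]
  exact Finset.sum_eq_single j₀ (fun j _ hj => afterIC_relaySignal_of_ne col ch j₀ hj _)
    (by simp)

end

lemma relayGain_le_one {J M : ℕ} (hJ : 0 < J) (hM : 0 < M) {P : ℝ} (hP : 0 ≤ P) :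
    relayGain J M P ≤ 1 := by
  have h1 : (1 : ℝ) ≤ J := by exact_mod_cast hJ
  have h2 : (1 : ℝ) ≤ M := by exact_mod_cast hM
  rw [relayGain, Real.sqrt_le_one, div_le_one (by positivity)]
  nlinarith [mul_nonneg (sub_nonneg.2 h1) hP,
    mul_nonneg (sub_nonneg.2 h2) (by positivity : 0 ≤ J * P + 1)]

/-! ### The normalized receive SNR near aligned channels -/

/-- A bound for `hᴴ R⁻¹ h` with `R` a covariance matrix: if `R` is invertible and `y = R⁻¹ h`, then
`γ = hᴴ y` equals the second moment of `yᴴ n`, and `γ² = |yᴴ h|²`; if `R` is singular, then `R⁻¹`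
is zero by convention. -/
lemma re_dotProduct_inv_mulVec_le {ι Ω : Type*} [Fintype ι] [DecidableEq ι] [MeasurableSpace Ω]
    {μ : Measure Ω} {n : Ω → ι → ℂ}
    (hn : ∀ i j, Integrable (fun ω => n ω i * conj (n ω j)) μ) {h : ι → ℂ} {B : ℝ} (hB : 0 ≤ B)
    (hle : ∀ y : ι → ℂ, ‖star y ⬝ᵥ h‖ ^ 2 ≤ B * ∫ ω, ‖star y ⬝ᵥ n ω‖ ^ 2 ∂μ) :
    (star h ⬝ᵥ ((Matrix.of fun i j => ∫ ω, n ω i * conj (n ω j) ∂μ)⁻¹ *ᵥ h)).re ≤ B := by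
  set R : Matrix ι ι ℂ := Matrix.of fun i j => ∫ ω, n ω i * conj (n ω j) ∂μ with hR
  by_cases hdet : IsUnit R.det
  swap
  · rw [Matrix.nonsing_inv_apply_not_isUnit _ hdet]
    simpa using hB
  set y := R⁻¹ *ᵥ h with hy
  have hRy : R *ᵥ y = h := by
    rw [hy, Matrix.mulVec_mulVec, Matrix.mul_nonsing_inv _ hdet, Matrix.one_mulVec]
  set I := ∫ ω, ‖star y ⬝ᵥ n ω‖ ^ 2 ∂μ with hI
  have hquad : star y ⬝ᵥ h = (I : ℂ) := by
    have h1 (ω : Ω) : ((‖star y ⬝ᵥ n ω‖ ^ 2 : ℝ) : ℂ) =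
        ∑ i, ∑ j, star (y i) * (n ω i * conj (n ω j)) * y j := by
      rw [← Complex.normSq_eq_norm_sq, ← Complex.mul_conj, dotProduct, map_sum,
        Finset.sum_mul_sum]
      refine Finset.sum_congr rfl fun i _ => Finset.sum_congr rfl fun j _ => ?_
      simp
      ring
    rw [hI, ← integral_complex_ofReal]
    simp only [h1]
    rw [integral_finsetSum _ fun i _ => integrable_finsetSum _ fun j _ =>
      ((hn i j).const_mul _).mul_const _, ← hRy]
    refine Finset.sum_congr rfl fun i _ => ?_
    rw [integral_finsetSum _ fun j _ => ((hn i j).const_mul _).mul_const _, Matrix.mulVec,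
      dotProduct, Finset.mul_sum]
    refine Finset.sum_congr rfl fun j _ => ?_
    rw [integral_mul_const, integral_const_mul, hR]
    simp only [Matrix.of_apply, Pi.star_apply]
    ring
  have hγ : (star h ⬝ᵥ y).re = I := by
    have : star h ⬝ᵥ y = star (star y ⬝ᵥ h) := by
      rw [Matrix.star_dotProduct]
    rw [this, hquad]
    simp
  have h2 := hle y
  rw [hquad, Complex.norm_real, Real.norm_eq_abs, sq_abs] at h2
  have hI0 : 0 ≤ I := integral_nonneg fun ω => by positivity
  rw [hγ]
  rcases hI0.eq_or_lt with h0 | h0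
  · linarith
  · nlinarith

lemma integrable_noiseLinear_mul_conj {m J M N : ℕ} (col : Fin M → Slot m) (ch : Channel J M N)
    (j₀ : Fin J) (P : ℝ) (o o' : ObsIdx m J N) :
    Integrable (fun z => noiseLinear col ch j₀ P z o * conj (noiseLinear col ch j₀ P z o'))
      (noiseLaw m M N) := by
  let L := (noiseLinear col ch j₀ P).toContinuousLinearMap
  refine ((integrable_sq_norm_noiseLaw m M N).const_mul (‖L‖ * ‖L‖)).mono'
    (Continuous.aestronglyMeasurable ?_) (Eventually.of_forall fun z => ?_)
  · have hc : Continuous (noiseLinear col ch j₀ P) := L.continuous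
    fun_prop
  · have h (o : ObsIdx m J N) : ‖noiseLinear col ch j₀ P z o‖ ≤ ‖L‖ * ‖z‖ :=
      (norm_le_pi_norm (L z) o).trans (L.le_opNorm z)
    rw [norm_mul, RCLike.norm_conj]
    calc _ ≤ (‖L‖ * ‖z‖) * (‖L‖ * ‖z‖) := mul_le_mul (h o) (h o') (norm_nonneg _) (by positivity)
      _ = _ := by ring

instance (m M : ℕ) : (volume : Measure (Fin M → Slot m → ℂ)).IsOpenPosMeasure :=
  Measure.pi.isOpenPosMeasure _

instance (m M N : ℕ) : (volume : Measure (Noise m M N)).IsOpenPosMeasure :=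
  Measure.prod.instIsOpenPosMeasure

instance (m M N : ℕ) : (volume : Measure (Noise m M N)).IsAddLeftInvariant :=
  Measure.prod.instIsAddLeftInvariant

/-- If the channel vector is what remains of a received signal `t • η`, then the SNR is `O(t²)`,
since the noise at the destination masks such signals. -/
lemma receiveSNR_le {m M N : ℕ} : ∃ C : ℝ, 0 < C ∧ ∀ {J : ℕ} (col : Fin M → Slot m)
    (ch : Channel J M N) (j₀ : Fin J) (P : ℝ) (k : Slot m) (t : ℝ) (η : Fin N → Slot m → ℂ),
    ‖η‖ ≤ 1 → channelVector col ch j₀ k = t • afterIC col ch j₀ η →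
      receiveSNR col P j₀ k ch ≤ C * t ^ 2 := by
  obtain ⟨C, hC, h⟩ := (dominatesVolume_noiseLaw m M N).exists_sq_norm_le
  refine ⟨C, hC, fun {J} col ch j₀ P k t η hη ht => ?_⟩
  refine re_dotProduct_inv_mulVec_le
    (integrable_noiseLinear_mul_conj col ch j₀ P) (by positivity) fun y => ?_
  let φ : Noise m M N →ₗ[ℝ] ℂ :=
    (dotProductBilin ℝ ℝ (star y)).comp (noiseLinear col ch j₀ P)
  have hφ (z) : φ z = star y ⬝ᵥ noiseLinear col ch j₀ P z := rfl
  have hint : Integrable (fun z => ‖φ z‖ ^ 2) (noiseLaw m M N) := by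
    let L := φ.toContinuousLinearMap
    refine ((integrable_sq_norm_noiseLaw m M N).const_mul (‖L‖ ^ 2)).mono'
      (Continuous.aestronglyMeasurable ?_) (Eventually.of_forall fun z => ?_)
    · have hc : Continuous φ := L.continuous
      fun_prop
    · rw [Real.norm_of_nonneg (by positivity), ← mul_pow]
      gcongr
      exact L.le_opNorm z
  have h1 := h φ hint ((0, η) : Noise m M N) (by simpa [Prod.norm_def] using hη)
  rw [hφ, noiseLinear_dest] at h1
  rw [ht, dotProduct_smul, norm_smul, mul_pow, Real.norm_eq_abs, sq_abs]
  calc t ^ 2 * ‖star y ⬝ᵥ afterIC col ch j₀ η‖ ^ 2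
      ≤ t ^ 2 * (C * ∫ z, ‖φ z‖ ^ 2 ∂(noiseLaw m M N)) := by gcongr
    _ = _ := by rw [← mul_assoc, mul_comm (t ^ 2)]; rfl

/-- Near aligned channels, all but a short remainder of the channel vector of Source `j₀` is
cancelled together with the other sources. -/
lemma exists_remainder {m J M N : ℕ} (col : Fin M → Slot m) {j₀ : Fin J} {δ : ℝ}
    {ch : Channel J M N} (hch : ch ∈ alignedChannels N j₀ δ) :
    ∃ d : Fin M → ℂ, (∀ i, ‖d i‖ ≤ δ) ∧ ∀ r, afterIC col ch j₀
      (relaySignal col ch.2 (ch.1 j₀) r) = afterIC col ch j₀ (relaySignal col ch.2 d r) := by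
  obtain ⟨⟨c, hc⟩, -⟩ := hch
  exact ⟨_, fun i => (hc i).le, afterIC_relaySignal_sub_sum col ch j₀ c⟩

lemma receiveSNR_le_of_mem {m M N : ℕ} : ∃ C : ℝ, 0 < C ∧ ∀ {J : ℕ} (col : Fin M → Slot m)
    (j₀ : Fin J) (P : ℝ) (k : Slot m) {δ : ℝ}, 0 < δ → ∀ ch ∈ alignedChannels N j₀ δ,
      receiveSNR col P j₀ k ch ≤ C * δ ^ 2 := by
  obtain ⟨C, hC, h⟩ := receiveSNR_le (m := m) (M := M) (N := N)
  refine ⟨C * (M + 1) ^ 2, by positivity, fun {J} col j₀ P k δ hδ ch hch => ?_⟩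
  obtain ⟨d, hd, hr⟩ := exists_remainder col hch
  have ht : (0 : ℝ) < (M + 1) * δ := by positivity
  refine (h col ch j₀ P k ((M + 1) * δ) (((M + 1) * δ)⁻¹ • relaySignal col ch.2 d (Pi.single k 1))
    ?_ ?_).trans_eq (by ring)
  · rw [norm_smul, norm_inv, Real.norm_of_nonneg ht.le, inv_mul_le_iff₀ ht, mul_one]
    refine (norm_relaySignal_le col (fun i n => (hch.2 i n).le) hδ.le hd zero_le_one
      fun σ => ?_).trans (by nlinarith)
    rw [Pi.single_apply]
    split_ifs <;> simp
  · rw [afterIC_smul, smul_smul, mul_inv_cancel₀ ht.ne', one_smul, channelVector_eq_afterIC, hr]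

/-! ### The bit error rate near aligned channels -/

/-- At power `P` and within `const / √P` of aligned channels, the received signals of Source `j₀`
for two messages differ by a bounded shift of the noise at the destination; so any decoder errs with
at least constant probability. -/
lemma exists_le_lintegral_errors {m M N q : ℕ} (hq : 0 < q) (col : Fin M → Slot m)
    (mod : Slot m → (Fin q → Bool) → ℂ) {J : ℕ} (j₀ : Fin J) (hM : 0 < M) :
    ∃ K : ℝ, 1 ≤ K ∧ ∃ c : ℝ≥0∞, c ≠ 0 ∧ ∀ P : ℝ, 1 ≤ P →
      ∀ D : Channel J M N → (ObsIdx m J N → ℂ) → Slot m → Fin q → Bool,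
      (Measurable fun x : Channel J M N × (ObsIdx m J N → ℂ) => D x.1 x.2) →
      ∀ ch ∈ alignedChannels N j₀ (1 / (K * √P)), c ≤ ∫⁻ z,
        (∑ b : Fin J → Slot m → Fin q → Bool, ∑ k : Slot m, ∑ i : Fin q,
          if D ch (observation col P ch j₀ (fun j τ => mod τ (b j τ)) z) k i = b j₀ k i
            then 0 else 1) /
          ((Fintype.card (Fin J → Slot m → Fin q → Bool) * Fintype.card (Slot m) * q : ℕ) : ℝ≥0∞)
        ∂(noiseLaw m M N) := by
  obtain ⟨c, hc, hshift⟩ := (dominatesVolume_noiseLaw m M N).exists_le_measure_add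
  have hM' : (1 : ℝ) ≤ M := by exact_mod_cast hM
  let ρ : ℝ := ∑ τ, ∑ x, ‖mod τ x‖
  have hρ0 : 0 ≤ ρ := by positivity
  have hρ (τ x) : ‖mod τ x‖ ≤ ρ :=
    (Finset.single_le_sum (f := fun x => ‖mod τ x‖) (fun _ _ => norm_nonneg _)
      (Finset.mem_univ x)).trans (Finset.single_le_sum (f := fun τ => ∑ x, ‖mod τ x‖)
        (fun _ _ => by positivity) (Finset.mem_univ τ))
  set T : ℕ := Fintype.card (Fin J → Slot m → Fin q → Bool) * Fintype.card (Slot m) * q with hT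
  -- this factor makes the received signal of every message at most `1 / 2`, see `hnorm`
  refine ⟨2 * M * (ρ + 1), by nlinarith, c / T, (ENNReal.div_pos hc (by simp)).ne',
    fun P hP D hD ch hch => ?_⟩
  obtain ⟨d, hd, hr⟩ := exists_remainder col hch
  have hP0 : 0 < √P := by positivity
  -- two messages that differ in every bit: where the decoder is right on one it errs on the other
  let b₀ : Fin J → Slot m → Fin q → Bool := fun _ _ _ => false
  let b₁ : Fin J → Slot m → Fin q → Bool := fun _ _ _ => true
  have hb : b₀ ≠ b₁ := fun h => Bool.false_ne_true (congrFun (congrFun (congrFun h j₀) 0) ⟨0, hq⟩)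
  let obs (b : Fin J → Slot m → Fin q → Bool) (z : Noise m M N) :=
    observation col P ch j₀ (fun j τ => mod τ (b j τ)) z
  let shift (b : Fin J → Slot m → Fin q → Bool) : Noise m M N :=
    (0, (√P * relayGain J M P) • relaySignal col ch.2 d (fun τ => mod τ (b j₀ τ)))
  have hobs (b) (z) : obs b z = noiseLinear col ch j₀ P (shift b + z) := by
    simp only [obs, shift]
    rw [map_add, noiseLinear_dest, observation_eq, hr, afterIC_smul, noiseLinear_apply]
  have hnorm (b) : ‖shift b‖ ≤ 1 / 2 := by
    simp only [shift, Prod.norm_def, norm_zero]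
    rw [max_eq_right (norm_nonneg _), norm_smul]
    have h1 := norm_relaySignal_le col (fun i n => (hch.2 i n).le) (by positivity) hd hρ0
      fun τ => hρ τ (b j₀ τ)
    have hg0 : 0 ≤ relayGain J M P := Real.sqrt_nonneg _
    have hg := relayGain_le_one (J := J) (Fin.pos j₀) hM (P := P) (by linarith)
    rw [Real.norm_of_nonneg (by positivity)]
    calc _ ≤ √P * 1 * (M * (1 / (2 * M * (ρ + 1) * √P) * ρ)) := by gcongr
      _ = ρ / (ρ + 1) / 2 := by field_simp
      _ ≤ 1 / 2 := by
        gcongr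
        rw [div_le_one (by positivity)]
        linarith
  let k : Slot m := 0
  let i : Fin q := ⟨0, hq⟩
  let A : Set (Noise m M N) := {z | D ch (obs b₀ z) k i ≠ b₀ j₀ k i}
  let A' : Set (Noise m M N) := {z | D ch (obs b₁ z) k i ≠ b₁ j₀ k i}
  have hmeas (b) : Measurable fun z => D ch (obs b z) k i := by
    have h1 : Measurable (obs b) := by
      have hc : Continuous (noiseLinear col ch j₀ P) :=
        (noiseLinear col ch j₀ P).continuous_of_finiteDimensional
      simp only [funext (hobs b)]
      exact (hc.comp (continuous_const.add continuous_id)).measurable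
    have h2 := hD.comp (measurable_prodMk_left.comp h1 : Measurable fun z => (ch, obs b z))
    exact (measurable_pi_apply i).comp ((measurable_pi_apply k).comp h2)
  have hA : MeasurableSet A := (hmeas b₀) (measurableSet_singleton (b₀ j₀ k i)).compl
  have hA' : MeasurableSet A' := (hmeas b₁) (measurableSet_singleton (b₁ j₀ k i)).compl
  have hpre : (fun z => (shift b₁ - shift b₀) + z) ⁻¹' Aᶜ = A' := by
    ext z
    have : obs b₀ ((shift b₁ - shift b₀) + z) = obs b₁ z := by
      rw [hobs, hobs, ← add_assoc, add_sub_cancel]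
    simp [A, A', this, b₀, b₁]
  have h1 := hshift (shift b₁ - shift b₀)
    ((norm_sub_le _ _).trans (by linarith [hnorm b₀, hnorm b₁])) A
  rw [hpre] at h1
  calc c / T ≤ (noiseLaw m M N A + noiseLaw m M N A') / T := by gcongr
    _ = ∫⁻ z, (A.indicator 1 z + A'.indicator 1 z) / T ∂(noiseLaw m M N) := by
      simp only [div_eq_mul_inv]
      rw [lintegral_mul_const _ (by measurability), lintegral_add_left (by measurability),
        lintegral_indicator_one hA, lintegral_indicator_one hA']
    _ ≤ _ := by
      refine lintegral_mono fun z => ENNReal.div_le_div_right ?_ _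
      let e (b : Fin J → Slot m → Fin q → Bool) (k : Slot m) (i : Fin q) : ℝ≥0∞ :=
        if D ch (obs b z) k i = b j₀ k i then 0 else 1
      have hsingle (b) : e b k i ≤ ∑ k, ∑ i, e b k i :=
        (Finset.single_le_sum (f := e b k) (fun _ _ => zero_le) (Finset.mem_univ i)).trans
          (Finset.single_le_sum (f := fun k => ∑ i, e b k i) (fun _ _ => zero_le)
            (Finset.mem_univ k))
      calc A.indicator 1 z + A'.indicator 1 z = e b₀ k i + e b₁ k i := by
            simp only [Set.indicator_apply, A, A', e, Set.mem_ofPred_eq, Pi.one_apply, ite_not]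
        _ ≤ (∑ k, ∑ i, e b₀ k i) + ∑ k, ∑ i, e b₁ k i := add_le_add (hsingle _) (hsingle _)
        _ = ∑ b ∈ {b₀, b₁}, ∑ k, ∑ i, e b k i := by rw [Finset.sum_pair hb]
        _ ≤ ∑ b, ∑ k, ∑ i, e b k i :=
          Finset.sum_le_sum_of_subset (Finset.subset_univ _)

/-! ### Diversity gains -/

lemma tendsto_log_mul_pow_div_log {c : ℝ} (hc : 0 < c) (d : ℕ) :
    Tendsto (fun x : ℝ => Real.log (c * x ^ d) / Real.log x) (𝓝[>] 0) (𝓝 d) := by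
  have h1 : Tendsto (fun x : ℝ => Real.log c / Real.log x + d) (𝓝[>] 0) (𝓝 (0 + d)) :=
    (Real.tendsto_log_nhdsGT_zero.const_div_atBot _).add_const _
  rw [zero_add] at h1
  refine h1.congr' ?_
  filter_upwards [Ioo_mem_nhdsGT one_pos] with x hx
  have hlog : Real.log x ≠ 0 := (Real.log_neg hx.1 hx.2).ne
  rw [Real.log_mul hc.ne' (pow_ne_zero _ hx.1.ne'), Real.log_pow]
  field_simp

/-- An error probability of at least `c * x ^ d` as `x → 0+` bounds the diversity gain by `d`. -/
lemma limsup_log_div_log_le {p : ℝ → ℝ≥0∞} {c x₀ : ℝ} (hc : 0 < c) (hx₀ : 0 < x₀) (d : ℕ)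
    (hp : ∀ x, 0 < x → x ≤ x₀ → ENNReal.ofReal (c * x ^ d) ≤ p x) :
    limsup (fun x : ℝ => ENNReal.log (p x) / (Real.log x : EReal)) (𝓝[>] 0) ≤ ((d : ℝ) : EReal) := by
  have hlim : Tendsto (fun x : ℝ => ((Real.log (c * x ^ d) / Real.log x : ℝ) : EReal)) (𝓝[>] 0)
      (𝓝 ((d : ℝ) : EReal)) :=
    (continuous_coe_real_ereal.tendsto _).comp (tendsto_log_mul_pow_div_log hc d)
  rw [← hlim.limsup_eq]
  refine limsup_le_limsup ?_
  filter_upwards [Ioo_mem_nhdsGT one_pos, Ioc_mem_nhdsGT hx₀] with x hx hx'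
  have hlog : Real.log x < 0 := Real.log_neg hx.1 hx.2
  have hpos : 0 < c * x ^ d := mul_pos hc (pow_pos hx.1 _)
  rw [EReal.coe_div]
  refine EReal.div_le_div_right_of_nonpos (by exact_mod_cast hlog.le) ?_
  rw [← ENNReal.log_ofReal_of_pos hpos]
  exact ENNReal.log_monotone (hp x hx.1 hx'.2)

lemma outageDiversity_le {J M : ℕ} (N : ℕ) (hJM : J ≤ M) {m : ℕ} (col : Fin M → Slot m)
    (j₀ : Fin J) (P : ℝ) (k : Slot m) :
    outageDiversity N col P j₀ k ≤ (((M - J + 1 : ℕ) : ℝ) : EReal) := by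
  obtain ⟨C, hC, hsnr⟩ := receiveSNR_le_of_mem (m := m) (M := M) (N := N)
  obtain ⟨c, hc, hprob⟩ := exists_le_channelLaw_alignedChannels N hJM j₀
  refine limsup_log_div_log_le (c := c / (2 * C) ^ (M - J + 1)) (x₀ := 2 * C) (by positivity)
    (by positivity) _ fun ε hε hε1 => ?_
  have hδ : 0 < √(ε / (2 * C)) := by positivity
  have hsq : √(ε / (2 * C)) ^ 2 = ε / (2 * C) := Real.sq_sqrt (by positivity)
  have h1 := hprob _ hδ (by rw [Real.sqrt_le_one, div_le_one (by positivity)]; exact hε1)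
  rw [pow_mul, hsq] at h1
  refine le_trans (le_of_eq ?_) (h1.trans (measure_mono fun ch hch => ?_))
  · rw [div_pow]
    congr 1
    ring
  · refine (hsnr col j₀ P k hδ ch hch).trans_lt ?_
    rw [hsq, show C * (ε / (2 * C)) = ε / 2 by field_simp]
    linarith

lemma exists_le_bitErrorRate {J M : ℕ} (N : ℕ) (hJM : J ≤ M) {m q : ℕ} (hq : 0 < q)
    (col : Fin M → Slot m) (mod : Slot m → (Fin q → Bool) → ℂ) (j₀ : Fin J) :
    ∃ c : ℝ, 0 < c ∧ ∀ P : ℝ, 1 ≤ P →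
      ∀ D : Channel J M N → (ObsIdx m J N → ℂ) → Slot m → Fin q → Bool,
      (Measurable fun x : Channel J M N × (ObsIdx m J N → ℂ) => D x.1 x.2) →
      ENNReal.ofReal (c * (P⁻¹) ^ (M - J + 1)) ≤ bitErrorRate col mod j₀ D P := by
  obtain ⟨K, hK, e, he, herr⟩ :=
    exists_le_lintegral_errors (N := N) hq col mod j₀ ((Fin.pos j₀).trans_le hJM)
  obtain ⟨c, hc, hprob⟩ := exists_le_channelLaw_alignedChannels N hJM j₀
  -- the minimum is a real number, as the constant in the conclusion has to be
  have het : min e 1 ≠ ⊤ := ne_top_of_le_ne_top ENNReal.one_ne_top (min_le_right _ _)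
  refine ⟨(min e 1).toReal * (c * (K⁻¹ ^ 2) ^ (M - J + 1)), ?_, fun P hP D hD => ?_⟩
  · have := ENNReal.toReal_pos (show min e 1 ≠ 0 by simp [min_eq_iff, he]) het
    positivity
  have hP0 : 0 < √P := by positivity
  have hP1 : 1 ≤ √P := Real.one_le_sqrt.2 hP
  set S : Set (Channel J M N) := alignedChannels N j₀ (1 / (K * √P)) with hS
  have h1 := hprob (1 / (K * √P)) (by positivity) (by
    rw [div_le_one (by positivity)]
    nlinarith)
  have h2 : (1 / (K * √P)) ^ (2 * (M - J + 1)) = (K⁻¹ ^ 2) ^ (M - J + 1) * P⁻¹ ^ (M - J + 1) := by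
    rw [pow_mul, ← mul_pow]
    congr 1
    rw [div_pow, mul_pow, Real.sq_sqrt (by linarith)]
    field_simp
  rw [h2] at h1
  calc ENNReal.ofReal ((min e 1).toReal * (c * (K⁻¹ ^ 2) ^ (M - J + 1)) * P⁻¹ ^ (M - J + 1))
      = min e 1 * ENNReal.ofReal (c * ((K⁻¹ ^ 2) ^ (M - J + 1) * P⁻¹ ^ (M - J + 1))) := by
        rw [mul_assoc, ENNReal.ofReal_mul ENNReal.toReal_nonneg, ENNReal.ofReal_toReal het]
        ring_nf
    _ ≤ e * channelLaw J M N S := mul_le_mul' (min_le_left _ _) h1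
    _ = ∫⁻ _ in S, e ∂(channelLaw J M N) := by rw [setLIntegral_const]
    _ ≤ ∫⁻ ch in S, _ ∂(channelLaw J M N) :=
        setLIntegral_mono_ae' (isOpen_alignedChannels j₀ _).measurableSet
          (Eventually.of_forall fun ch hch => herr P hP D hD ch hch)
    _ ≤ bitErrorRate col mod j₀ D P := setLIntegral_le_lintegral _ _

/-- The limit `P → ∞` is turned into `x → 0+` by `x = P⁻¹`. -/
lemma berDiversity_le {J M N : ℕ} (hJM : J ≤ M) {m q : ℕ} (hq : 0 < q)
    (col : Fin M → Slot m) (mod : Slot m → (Fin q → Bool) → ℂ) (j₀ : Fin J)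
    (D : ℝ → Channel J M N → (ObsIdx m J N → ℂ) → Slot m → Fin q → Bool)
    (hD : ∀ P : ℝ, Measurable fun x : Channel J M N × (ObsIdx m J N → ℂ) => D P x.1 x.2) :
    berDiversity col mod j₀ D ≤ (((M - J + 1 : ℕ) : ℝ) : EReal) := by
  obtain ⟨c, hc, h⟩ := exists_le_bitErrorRate N hJM hq col mod j₀
  have h1 := limsup_log_div_log_le (p := fun x => bitErrorRate col mod j₀ (D x⁻¹) x⁻¹) hc one_pos
    (M - J + 1) fun x hx hx1 => by
      simpa using h x⁻¹ ((one_le_inv₀ hx).2 hx1) _ (hD x⁻¹)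
  refine le_trans (le_of_eq ?_) (tendsto_inv_atTop_nhdsGT_zero.limsup_comp_le_limsup.trans h1)
  refine congrArg (limsup · atTop) (funext fun P => ?_)
  simp only [Function.comp_apply, inv_inv, Real.log_inv, EReal.coe_neg, div_eq_mul_inv,
    EReal.inv_neg, neg_mul, mul_neg]

end MARN

theorem theorem1 (J M N : ℕ) (hJM : J ≤ M) (hJN : J ≤ N)
    (m : ℕ) (col : Fin M → MARN.Slot m) (hcol : Function.Injective col) (j₀ : Fin J) :
    (∀ P : ℝ, 0 < P → ∀ k : MARN.Slot m,
      MARN.outageDiversity N col P j₀ k ≤ (((M : ℝ) - (J : ℝ) + 1 : ℝ) : EReal)) ∧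
    (∀ (q : ℕ), 0 < q → ∀ (mod : MARN.Slot m → (Fin q → Bool) → ℂ)
      (D : ℝ → MARN.Channel J M N → (MARN.ObsIdx m J N → ℂ) → MARN.Slot m → Fin q → Bool),
      (∀ P : ℝ, Measurable fun x : MARN.Channel J M N × (MARN.ObsIdx m J N → ℂ) => D P x.1 x.2) →
      MARN.berDiversity col mod j₀ D ≤ (((M : ℝ) - (J : ℝ) + 1 : ℝ) : EReal)) := by
  have h : (M : ℝ) - J + 1 = ((M - J + 1 : ℕ) : ℝ) := by push_cast [hJM]; ring
  rw [h]
  exact ⟨fun P _ k => MARN.outageDiversity_le N hJM col j₀ P k,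
    fun q hq mod D hD => MARN.berDiversity_le hJM hq col mod j₀ D hD⟩
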